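/- Let $n\ge 2$ and $s\in(0,1)$. For an open set $\Omega\subset\mathbb R^m$ put $$\widetilde H^s(\Omega)=\{u\in L_2(\mathbb R^m)\colon |\xi|^s\mathcal F u(\xi)\in L_2(\mathbb R^m),\ \operatorname{supp}u\subset\overline\Omega\},\qquad a_s^\Omega[u]=\int_{\mathbb R^m}|\xi|^{2s}|\mathcal F u(\xi)|^2\,d\xi ,$$ where $\mathcal F u(\xi)=(2\pi)^{-m/2}\int_{\mathbb R^m}e^{-i\xi\cdot x}u(x)\,dx$ is the unitary Fourier transform on the complex space $L_2(\mathbb R^m)$. The restricted Dirichlet fractional Laplacian $\mathcal A_s^\Omega$ is the self-adjoint operator generated by the closed form $a_s^\Omega$ with domain $\widetilde H^s(\Omega)$, acting in the closure of $\widetilde H^s(\Omega)$ in $L_2(\mathbb R^m)$ (this closure is $L_2(\Omega)$ whenever $\partial\Omega$ is a null set): $u\in\operatorname{Dom}(\mathcal A_s^\Omega)$ and $\mathcal A_s^\Omega u=f$ mean that $u\in\widetilde H^s(\Omega)$ and $a_s^\Omega(u,v)=(f,v)_{L_2}$ for all $v\in\widetilde H^s(\Omega)$. Let $\omega\subset\mathbb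 R^{n-1}$ be a bounded domain (non-empty, open, connected, bounded), and let $\mathcal Q=\omega\times\mathbb R_+\subset\mathbb R^n$ be the semi-tube over $\omega$. Then $\mathcal A_s^\omega$ has a smallest eigenvalue $\Lambda_s$, and the spectrum of $\mathcal A_s^{\mathcal Q}$ coincides with the ray $[\Lambda_s,+\infty)$. -/

import Mathlib

open MeasureTheory Set
open scoped FourierTransform InnerProductSpace

noncomputable section

/-! ## Spectrum of an unbounded operator -/

section Spectrum

variable {H : Type*} [NormedAddCommGroup H] [NormedSpace ℂ H]

/-- The resolvent set of an unbounded operator `A`: all `μ ∈ ℂ` such that `A - μ` is a bijection of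
the domain of `A` onto `H` with an (everywhere defined) bounded inverse `R`. -/
def LinearPMap.resolventSetC (A : H →ₗ.[ℂ] H) : Set ℂ :=
  {μ | ∃ R : H →L[ℂ] H,
    (∀ x : A.domain, R (A x - μ • (x : H)) = x) ∧
    (∀ y : H, ∃ x : A.domain, (x : H) = R y ∧ A x - μ • (x : H) = y)}

/-- The spectrum of an unbounded operator, as a subset of `ℂ`. -/
def LinearPMap.spectrumC (A : H →ₗ.[ℂ] H) : Set ℂ := (A.resolventSetC)ᶜ

/-- The set of real eigenvalues of an unbounded operator. -/
def LinearPMap.realEigenvalues (A : H →ₗ.[ℂ] H) : Set ℝ :=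
  {l | ∃ x : A.domain, (x : H) ≠ 0 ∧ A x = (l : ℂ) • (x : H)}

end Spectrum

/-! ## The restricted Dirichlet fractional Laplacian -/

namespace FracDirichlet

variable {E : Type*} [NormedAddCommGroup E] [InnerProductSpace ℝ E] [FiniteDimensional ℝ E]
  [MeasurableSpace E] [BorelSpace E]

/-- Complex-valued square integrable functions on the Euclidean space `E`. -/
abbrev L2 (E : Type*) [NormedAddCommGroup E] [InnerProductSpace ℝ E] [FiniteDimensional ℝ E]
    [MeasurableSpace E] [BorelSpace E] : Type _ :=
  Lp (α := E) ℂ 2 (volume : Measure E)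

/-- The function `(2π|ξ|)^s · 𝓕 u (ξ)`, where `𝓕` is the unitary Fourier transform on `L²` with kernel
`exp (-2πi ξ·x)`. In the normalization `(2π)^(-n/2) ∫ exp (-i ξ·x) u(x) dx` of the Fourier transform
it is, up to the `L²`-isometric dilation `ξ ↦ 2πξ`, the function `|ξ|^s · F u (ξ)`. -/
def fracSymbol (s : ℝ) (u : L2 E) : E → ℂ :=
  fun ξ ↦ (((2 * Real.pi * ‖ξ‖) ^ s : ℝ) : ℂ) * (𝓕 u : L2 E) ξ

lemma fracSymbol_add (s : ℝ) (u v : L2 E) :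
    fracSymbol s (u + v) =ᵐ[volume] fracSymbol s u + fracSymbol s v := by
  have h : (𝓕 (u + v) : L2 E) = 𝓕 u + 𝓕 v := FourierTransform.fourier_add u v
  unfold fracSymbol
  rw [h]
  filter_upwards [Lp.coeFn_add (𝓕 u : L2 E) (𝓕 v : L2 E)] with ξ hξ
  simp only [hξ, Pi.add_apply]
  ring

lemma fracSymbol_smul (s : ℝ) (c : ℂ) (u : L2 E) :
    fracSymbol s (c • u) =ᵐ[volume] c • fracSymbol s u := by
  have h : (𝓕 (c • u) : L2 E) = c • 𝓕 u := FourierTransform.fourier_smul c u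
  unfold fracSymbol
  rw [h]
  filter_upwards [Lp.coeFn_smul c (𝓕 u : L2 E)] with ξ hξ
  simp only [hξ, Pi.smul_apply, smul_eq_mul]
  ring

lemma fracSymbol_zero (s : ℝ) : fracSymbol s (0 : L2 E) =ᵐ[volume] 0 := by
  have h := fracSymbol_smul s (0 : ℂ) (0 : L2 E)
  simpa using h

/-- The space `H̃ˢ(Ω) = {u ∈ Hˢ(ℝⁿ) : supp u ⊆ closure Ω}`, where
`Hˢ(ℝⁿ) = {u ∈ L² : |ξ|ˢ F u ∈ L²}`. As the complement of `closure Ω` is open, the condition on the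
support says that `u` vanishes almost everywhere outside `closure Ω`. -/
def formDomain (s : ℝ) (Ω : Set E) : Submodule ℂ (L2 E) where
  carrier := {u | MemLp (fracSymbol s u) 2 volume ∧ ∀ᵐ x : E, x ∉ closure Ω → u x = 0}
  add_mem' := by
    rintro u v ⟨hu, hu'⟩ ⟨hv, hv'⟩
    refine ⟨(memLp_congr_ae (fracSymbol_add s u v)).2 (hu.add hv), ?_⟩
    filter_upwards [hu', hv', Lp.coeFn_add u v] with x h1 h2 h3 hx
    rw [h3, Pi.add_apply, h1 hx, h2 hx, add_zero]
  zero_mem' := by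
    refine ⟨(memLp_congr_ae (fracSymbol_zero s)).2 MemLp.zero, ?_⟩
    filter_upwards [Lp.coeFn_zero ℂ 2 (volume : Measure E)] with x h _
    exact h
  smul_mem' := by
    rintro c u ⟨hu, hu'⟩
    refine ⟨(memLp_congr_ae (fracSymbol_smul s c u)).2 (hu.const_smul c), ?_⟩
    filter_upwards [hu', Lp.coeFn_smul c u] with x h1 h3 hx
    simp [h3, h1 hx]

/-- The sesquilinear form `a_s(v, u) = ∫ |ξ|^(2s) conj (F v (ξ)) F u (ξ) dξ` (antilinear in `v`),
whose quadratic form is `a_s[u] = ∫ |ξ|^(2s) |F u (ξ)|² dξ`. -/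
def fracForm (s : ℝ) (v u : L2 E) : ℂ := ∫ ξ, ⟪fracSymbol s v ξ, fracSymbol s u ξ⟫_ℂ

lemma fracForm_add_right {s : ℝ} {v u₁ u₂ : L2 E} (hv : MemLp (fracSymbol s v) 2 volume)
    (h₁ : MemLp (fracSymbol s u₁) 2 volume) (h₂ : MemLp (fracSymbol s u₂) 2 volume) :
    fracForm s v (u₁ + u₂) = fracForm s v u₁ + fracForm s v u₂ := by
  have i₁ : Integrable (fun ξ ↦ ⟪fracSymbol s v ξ, fracSymbol s u₁ ξ⟫_ℂ) volume := by
    simpa only [RCLike.inner_apply, Pi.mul_apply, Pi.star_apply, RCLike.star_def] using!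
      h₁.integrable_mul hv.star
  have i₂ : Integrable (fun ξ ↦ ⟪fracSymbol s v ξ, fracSymbol s u₂ ξ⟫_ℂ) volume := by
    simpa only [RCLike.inner_apply, Pi.mul_apply, Pi.star_apply, RCLike.star_def] using!
      h₂.integrable_mul hv.star
  unfold fracForm
  rw [← integral_add i₁ i₂]
  refine integral_congr_ae ?_
  filter_upwards [fracSymbol_add s u₁ u₂] with ξ hξ
  simp only [hξ, Pi.add_apply, inner_add_right]

lemma fracForm_smul_right (s : ℝ) (c : ℂ) (v u : L2 E) :
    fracForm s v (c • u) = c * fracForm s v u := by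
  unfold fracForm
  rw [← integral_const_mul]
  refine integral_congr_ae ?_
  filter_upwards [fracSymbol_smul s c u] with ξ hξ
  simp only [hξ, Pi.smul_apply, inner_smul_right]

lemma fracForm_zero_right (s : ℝ) (v : L2 E) : fracForm s v 0 = 0 := by
  simpa using fracForm_smul_right s 0 v 0

/-- The Hilbert space in which the operator acts: the closure of the form domain in `L²`, with the
inner product of `L²`. If `Ω` is open and its boundary is a null set, this is the space of all
elements of `L²` that vanish almost everywhere outside `Ω`, that is, `L²(Ω)`. -/
abbrev stateSpace (s : ℝ) (Ω : Set E) : Submodule ℂ (L2 E) := (formDomain s Ω).topologicalClosure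

/-- The graph of the operator associated with the form `a_s` on `H̃ˢ(Ω)`: the pairs `(u, f)` with
`u ∈ H̃ˢ(Ω)` and `a_s(v, u) = (v, f)` for all `v ∈ H̃ˢ(Ω)`. -/
def operatorGraph (s : ℝ) (Ω : Set E) : Submodule ℂ (stateSpace s Ω × stateSpace s Ω) where
  carrier := {p | (p.1 : L2 E) ∈ formDomain s Ω ∧
    ∀ v ∈ formDomain s Ω, fracForm s v (p.1 : L2 E) = ⟪v, (p.2 : L2 E)⟫_ℂ}
  add_mem' := by
    rintro p q ⟨hp, hp'⟩ ⟨hq, hq'⟩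
    refine ⟨(formDomain s Ω).add_mem hp hq, fun v hv ↦ ?_⟩
    have h := fracForm_add_right hv.1 hp.1 hq.1
    simp only [Prod.fst_add, Prod.snd_add, Submodule.coe_add, inner_add_right]
    rw [h, hp' v hv, hq' v hv]
  zero_mem' := by
    refine ⟨(formDomain s Ω).zero_mem, fun v _ ↦ ?_⟩
    simpa using fracForm_zero_right s v
  smul_mem' := by
    rintro c p ⟨hp, hp'⟩
    refine ⟨(formDomain s Ω).smul_mem c hp, fun v hv ↦ ?_⟩
    simp only [Prod.smul_fst, Prod.smul_snd, Submodule.coe_smul, inner_smul_right]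
    rw [fracForm_smul_right, hp' v hv]

lemma operatorGraph_snd_eq_zero (s : ℝ) (Ω : Set E) (p : stateSpace s Ω × stateSpace s Ω)
    (hp : p ∈ operatorGraph s Ω) (h0 : p.1 = 0) : p.2 = 0 := by
  have h : ∀ v ∈ formDomain s Ω, ⟪v, (p.2 : L2 E)⟫_ℂ = 0 := by
    intro v hv
    rw [← hp.2 v hv, h0]
    exact fracForm_zero_right s v
  have hmem : (p.2 : L2 E) ∈ (formDomain s Ω)ᗮ := (Submodule.mem_orthogonal _ _).2 h
  rw [← Submodule.orthogonal_closure] at hmem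
  have h2 : ⟪(p.2 : L2 E), (p.2 : L2 E)⟫_ℂ = 0 := (Submodule.mem_orthogonal _ _).1 hmem _ p.2.2
  exact Subtype.ext (inner_self_eq_zero.1 h2)

/-- The restricted Dirichlet fractional Laplacian `A_s` in `Ω`: the operator generated by the
quadratic form `a_s` with domain `H̃ˢ(Ω)`. -/
def operator (s : ℝ) (Ω : Set E) : stateSpace s Ω →ₗ.[ℂ] stateSpace s Ω :=
  (operatorGraph s Ω).toLinearPMap

lemma operator_graph (s : ℝ) (Ω : Set E) : (operator s Ω).graph = operatorGraph s Ω :=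
  (operatorGraph s Ω).toLinearPMap_graph_eq (operatorGraph_snd_eq_zero s Ω)

/-- The semi-tube `ω × ℝ₊` in `ℝᵈ × ℝ`, equipped with the Euclidean norm. -/
def semiTube {d : ℕ} (ω : Set (EuclideanSpace ℝ (Fin d))) :
    Set (WithLp 2 (EuclideanSpace ℝ (Fin d) × ℝ)) :=
  {x | x.fst ∈ ω ∧ 0 < x.snd}

end FracDirichlet

end

/-!
The form domain of the fractional Laplacian in `Ω`, with squared norm `‖u‖² + a_s[u]`, is the Hilbert
space `formGraph (fracWeight s) Ω` of pairs `(u, b · 𝓕 u)`, `b ξ = (2π‖ξ‖)ˢ`. If `P` denotes its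
embedding into the state space, then `(A_s + 1)⁻¹ = P P†` (`mem_operator_graph_iff`), so that
spectral questions about `A_s` become questions about `P`.

Write `(ξ, τ)` for the frequencies in `ℝᵈ × ℝ` and `b_η ξ = (2π‖(ξ, η)‖)ˢ` for the weight with the
axial frequency frozen at `η`. Over the bounded set `ω` the embedding of the form domain of `b_η` is
compact (`exists_subseq_cauchySeq_formFst`), so it attains its norm; this gives a ground state with
an energy `Λ(η)` which is the minimum of the form and satisfies the Euler–Lagrange equation
(`exists_isGroundState`). For `η = 0` the energy `Λ = Λ(0)` is the smallest eigenvalue over `ω`.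

*Lower bound.* As `‖(ξ, τ)‖ ≥ ‖ξ‖`, it suffices to bound the form with the weight `b_0` that ignores
`τ`. This is done by expanding along an orthonormal basis of `L²` of the axis: partial inner
products with the basis functions are supported in `closure ω`, and the Fourier transform intertwines
partial inner products (`fourier_partialInner`), whence `lower_bound_cylinder`. So the spectrum over the
semi-tube lies in `[Λ, ∞)`.

*All of `[Λ, ∞)` is spectrum.* The separable function `φ(x) exp (2πiηy) χ(y)` is almost an
eigenfunction when `φ` is the ground state at frequency `η`, not the one at frequency zero, and `χ`
varies slowly on the half-line. Since `s ≤ 1`, one has `|b_τ ξ - b_η ξ| ≤ (2π|τ - η|)ˢ` uniformly in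
`ξ` (`abs_weight_sub_le`). This bounds the error in the eigenvalue equation with eigenvalue `Λ(η)`
(`exists_approx_eigenfunction`), and it also makes `√Λ(η)` continuous in `η`. As `√Λ(η) ≥ (2π|η|)ˢ`
is unbounded, `Λ(η)` takes every value in `[Λ, ∞)` (`exists_isGroundState_of_le`), and Weyl's
criterion (`LinearPMap.mem_spectrumC_of_approx`) applies to each of them.
-/

noncomputable section

set_option linter.unusedSectionVars false

/-! ### Compact operators, resolvents and spectra in Hilbert space -/

section Resolvent

variable {H : Type*} [NormedAddCommGroup H] [NormedSpace ℂ H]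

/-- If `K = (A + 1)⁻¹`, expressed through the graph of `A`, then `l` lies in the resolvent set of
`A` exactly when `1 - (l + 1) K` is invertible. -/
theorem LinearPMap.mem_resolventSetC_iff_isUnit {A : H →ₗ.[ℂ] H} {K : H →L[ℂ] H}
    (hA : ∀ x y : H, (x, y) ∈ A.graph ↔ K (x + y) = x) (l : ℂ) :
    l ∈ A.resolventSetC ↔ IsUnit (1 - (l + 1) • K) := by
  constructor
  · rintro ⟨R, hR1, hR2⟩
    refine isUnit_iff_exists.2 ⟨1 + (l + 1) • R, ?_, ?_⟩
    · ext y
      obtain ⟨x, hx1, hx2⟩ := hR2 y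
      have h1 := (hA _ _).1 (A.mem_graph x)
      have h2 : (x : H) + A x = y + (l + 1) • R y := by
        rw [← hx1, ← hx2]; module
      rw [h2, hx1] at h1
      simp only [mul_apply_eq_comp, _root_.sub_apply,
        _root_.add_apply, one_apply_eq_self,
        _root_.smul_apply, h1]
      module
    · ext f
      have h1 : (K f, f - K f) ∈ A.graph := (hA _ _).2 (by simp)
      obtain ⟨x, hx1, hx2⟩ := (A.mem_graph_iff).1 h1
      have h2 := hR1 x
      simp only at hx1 hx2
      rw [hx1, hx2] at h2
      have h3 : f - (l + 1) • K f = f - K f - l • K f := by module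
      simp only [mul_apply_eq_comp, _root_.sub_apply,
        _root_.add_apply, one_apply_eq_self,
        _root_.smul_apply]
      rw [h3, h2]
      module
  · intro h
    obtain ⟨B, hB1, hB2⟩ := isUnit_iff_exists.1 h
    refine ⟨B * K, fun x ↦ ?_, fun y ↦ ?_⟩
    · have h1 := (hA _ _).1 (A.mem_graph x)
      have h2 : K (A x - l • (x : H)) = (1 - (l + 1) • K) (x : H) := by
        have : A x - l • (x : H) = ((x : H) + A x) - (l + 1) • (x : H) := by module
        rw [this, _root_.map_sub K, h1, _root_.map_smul K]
        simp
      rw [mul_apply_eq_comp, h2, ← mul_apply_eq_comp, hB2]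
      simp
    · set x := (B * K) y with hx
      have h1 : (1 - (l + 1) • K) x = K y := by
        rw [hx, mul_apply_eq_comp, ← mul_apply_eq_comp, hB1]
        simp
      have h2 : (x, y + l • x) ∈ A.graph := by
        rw [hA]
        have : x + (y + l • x) = y + (l + 1) • x := by module
        rw [this, _root_.map_add K, _root_.map_smul K, ← h1]
        simp
      obtain ⟨z, hz1, hz2⟩ := (A.mem_graph_iff).1 h2
      simp only at hz1 hz2
      exact ⟨z, hz1, by rw [hz1, hz2]; simp⟩

end Resolvent

section Abstract

variable {G H : Type*} [NormedAddCommGroup G] [InnerProductSpace ℂ G] [CompleteSpace G]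
  [NormedAddCommGroup H] [InnerProductSpace ℂ H] [CompleteSpace H]

open ContinuousLinearMap in
/-- A compact operator between Hilbert spaces attains its norm: `‖P‖²` is an eigenvalue of
`P† P`. Compactness is used in sequential form. -/
theorem exists_adjoint_apply_eq_norm_sq_smul (P : G →L[ℂ] H) (hP : P ≠ 0)
    (hc : ∀ g : ℕ → G, (∀ k, ‖g k‖ ≤ 1) →
      ∃ φ : ℕ → ℕ, StrictMono φ ∧ CauchySeq fun k ↦ P (g (φ k))) :
    ∃ g : G, g ≠ 0 ∧ (adjoint P) (P g) = ((‖P‖ ^ 2 : ℝ) : ℂ) • g := by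
  have hpos : 0 < ‖P‖ := norm_pos_iff.2 hP
  have key : ∀ k : ℕ, ∃ g : G, ‖g‖ ≤ 1 ∧ ‖P‖ - ‖P‖ / (k + 1) ≤ ‖P g‖ := by
    intro k
    by_contra! hcon
    have hk : (0 : ℝ) < k + 1 := by positivity
    have h0 : 0 ≤ ‖P‖ - ‖P‖ / (k + 1) := by
      rw [sub_nonneg, div_le_iff₀ hk]
      nlinarith [(Nat.cast_nonneg k : (0 : ℝ) ≤ k)]
    have := P.opNorm_le_of_unit_norm h0 (fun x hx ↦ (hcon x hx.le).le)
    have : 0 < ‖P‖ / (k + 1) := by positivity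
    linarith
  choose g hg1 hg2 using key
  obtain ⟨φ, hφ, hcau⟩ := hc g hg1
  obtain ⟨y, hy⟩ := cauchySeq_tendsto_of_complete hcau
  have hnorm : Filter.Tendsto (fun k ↦ ‖P (g k)‖) Filter.atTop (nhds ‖P‖) := by
    refine tendsto_of_tendsto_of_tendsto_of_le_of_le (g := fun k : ℕ ↦ ‖P‖ - ‖P‖ / (k + 1))
      (h := fun _ ↦ ‖P‖) ?_ tendsto_const_nhds hg2 ?_
    · have : Filter.Tendsto (fun k : ℕ ↦ ‖P‖ * (1 / ((k : ℝ) + 1))) Filter.atTop (nhds (‖P‖ * 0)) :=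
        tendsto_one_div_add_atTop_nhds_zero_nat.const_mul _
      simpa [mul_one_div] using! (tendsto_const_nhds (x := ‖P‖)).sub this
    · intro k
      simpa using P.le_opNorm_of_le (hg1 k)
  -- `‖P†P g - ‖P‖² g‖² ≤ 2 ‖P‖² (‖P‖² - ‖P g‖²)` for `‖g‖ ≤ 1`
  have hdiff : Filter.Tendsto (fun k ↦ (adjoint P) (P (g k)) - ((‖P‖ ^ 2 : ℝ) : ℂ) • g k)
      Filter.atTop (nhds 0) := by
    rw [tendsto_zero_iff_norm_tendsto_zero]
    have hsq : ∀ k, ‖(adjoint P) (P (g k)) - ((‖P‖ ^ 2 : ℝ) : ℂ) • g k‖ ≤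
        √(2 * ‖P‖ ^ 2 * (‖P‖ ^ 2 - ‖P (g k)‖ ^ 2)) := by
      intro k
      apply Real.le_sqrt_of_sq_le
      rw [@norm_sub_sq ℂ]
      have e1 : RCLike.re ⟪(adjoint P) (P (g k)), ((‖P‖ ^ 2 : ℝ) : ℂ) • g k⟫_ℂ =
          ‖P‖ ^ 2 * ‖P (g k)‖ ^ 2 := by
        rw [inner_smul_right, adjoint_inner_left, inner_self_eq_norm_sq_to_K]
        simp [← Complex.ofReal_pow, ← Complex.ofReal_mul]
      have e2 : ‖(adjoint P) (P (g k))‖ ≤ ‖P‖ * ‖P (g k)‖ := by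
        simpa using (adjoint P).le_opNorm (P (g k))
      have e3 : ‖((‖P‖ ^ 2 : ℝ) : ℂ) • g k‖ ≤ ‖P‖ ^ 2 := by
        rw [norm_smul, Complex.norm_real, Real.norm_of_nonneg (by positivity)]
        nlinarith [hg1 k, sq_nonneg ‖P‖]
      have e4 := P.le_opNorm_of_le (hg1 k)
      rw [mul_one] at e4
      rw [e1]
      have e5 : ‖(adjoint P) (P (g k))‖ ^ 2 ≤ ‖P‖ ^ 2 * ‖P‖ ^ 2 := by
        calc _ ≤ (‖P‖ * ‖P (g k)‖) ^ 2 := by gcongr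
          _ ≤ (‖P‖ * ‖P‖) ^ 2 := by gcongr
          _ = _ := by ring
      have e6 : ‖((‖P‖ ^ 2 : ℝ) : ℂ) • g k‖ ^ 2 ≤ (‖P‖ ^ 2) ^ 2 := by gcongr
      nlinarith
    refine squeeze_zero (fun _ ↦ norm_nonneg _) hsq ?_
    have := ((((hnorm.pow 2).const_sub (‖P‖ ^ 2)).const_mul (2 * ‖P‖ ^ 2))).sqrt
    simpa using this
  have hlim : Filter.Tendsto (fun k ↦ ((‖P‖ ^ 2 : ℝ) : ℂ) • g (φ k)) Filter.atTop
      (nhds ((adjoint P) y)) := by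
    have h1 := (((adjoint P).continuous.tendsto y).comp hy).sub (hdiff.comp hφ.tendsto_atTop)
    simpa [Function.comp_def] using h1
  have hne : ((‖P‖ ^ 2 : ℝ) : ℂ) ≠ 0 := by exact_mod_cast (pow_pos hpos 2).ne'
  have hlim2 : Filter.Tendsto (fun k ↦ g (φ k)) Filter.atTop
      (nhds (((‖P‖ ^ 2 : ℝ) : ℂ)⁻¹ • (adjoint P) y)) := by
    have := hlim.const_smul (((‖P‖ ^ 2 : ℝ) : ℂ)⁻¹)
    simpa only [smul_smul, inv_mul_cancel₀ hne, one_smul] using this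
  set x := ((‖P‖ ^ 2 : ℝ) : ℂ)⁻¹ • (adjoint P) y with hx
  have hPx : P x = y := tendsto_nhds_unique ((P.continuous.tendsto x).comp hlim2) hy
  refine ⟨x, ?_, ?_⟩
  · rintro h0
    have : ‖P‖ = ‖y‖ := tendsto_nhds_unique (hnorm.comp hφ.tendsto_atTop) hy.norm
    rw [← hPx, h0, map_zero, norm_zero] at this
    exact hpos.ne' this
  · rw [hPx, hx, smul_smul, mul_inv_cancel₀ hne, one_smul]

/-- Lower semiboundedness of the form gives the lower bound of the spectrum. -/
theorem LinearPMap.spectrumC_subset_of_le {A : H →ₗ.[ℂ] H} (P : G →L[ℂ] H)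
    (hA : ∀ x y : H, (x, y) ∈ A.graph ↔ P (ContinuousLinearMap.adjoint P (x + y)) = x)
    {L : ℝ} (hL : 0 ≤ L)
    (hP : ∀ g, (1 + L) * ‖P g‖ ^ 2 ≤ ‖g‖ ^ 2) :
    A.spectrumC ⊆ (fun t : ℝ ↦ (t : ℂ)) '' Set.Ici L := by
  intro l hl
  set K : H →L[ℂ] H := P ∘L ContinuousLinearMap.adjoint P with hK
  have hl' : ¬ IsUnit (1 - (l + 1) • K) := by
    rw [← LinearPMap.mem_resolventSetC_iff_isUnit (A := A) (K := K) (by simpa [hK] using hA)]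
    exact hl
  have hl1 : l + 1 ≠ 0 := by
    intro h
    apply hl'
    rw [h, zero_smul, sub_zero]
    exact isUnit_one
  have hspec : (l + 1)⁻¹ ∈ spectrum ℂ K := by
    rw [spectrum.mem_iff]
    intro h
    apply hl'
    have : (1 - (l + 1) • K) = (Units.mk0 _ hl1) •
        (algebraMap ℂ (H →L[ℂ] H) (l + 1)⁻¹ - K) := by
      rw [Units.smul_mk0, smul_sub, Algebra.algebraMap_eq_smul_one, smul_smul,
        mul_inv_cancel₀ hl1, one_smul]
    rw [this]
    exact h.smul _
  have hpos : 0 ≤ K := (ContinuousLinearMap.nonneg_iff_isPositive K).2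
    (ContinuousLinearMap.isPositive_self_comp_adjoint P)
  have hre := (IsSelfAdjoint.of_nonneg hpos).mem_spectrum_eq_re hspec
  set t : ℝ := ((l + 1)⁻¹).re with ht
  have ht0 : 0 < t := by
    have h1 : t ∈ spectrum ℝ K := by
      rw [hre] at hspec
      exact (spectrum.algebraMap_mem_iff ℂ).1 hspec
    refine lt_of_le_of_ne (spectrum_nonneg_of_nonneg hpos h1) fun h ↦ inv_ne_zero hl1 ?_
    rw [hre, ← h, Complex.ofReal_zero]
  have hPn : (1 + L) * ‖P‖ ^ 2 ≤ 1 := by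
    have h1 : ‖P‖ ≤ √(1 / (1 + L)) := by
      refine P.opNorm_le_bound (by positivity) fun g ↦ ?_
      rw [← Real.sqrt_sq (norm_nonneg g), ← Real.sqrt_mul (by positivity)]
      apply Real.le_sqrt_of_sq_le
      rw [div_mul_eq_mul_div, one_mul, le_div_iff₀ (by positivity), mul_comm]
      exact hP g
    have h2 : ‖P‖ ^ 2 ≤ 1 / (1 + L) := by
      calc ‖P‖ ^ 2 ≤ √(1 / (1 + L)) ^ 2 := by gcongr
        _ = _ := Real.sq_sqrt (by positivity)
    rwa [le_div_iff₀ (by positivity), mul_comm] at h2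
  have htK : t ≤ ‖P‖ ^ 2 := by
    have h1 := spectrum.norm_le_norm_mul_of_mem hspec
    rw [hre, Complex.norm_real, Real.norm_of_nonneg ht0.le] at h1
    have h2 : ‖(1 : H →L[ℂ] H)‖ ≤ 1 := ContinuousLinearMap.norm_id_le
    have h3 : ‖K‖ ≤ ‖P‖ ^ 2 := by
      refine (ContinuousLinearMap.opNorm_comp_le _ _).trans ?_
      rw [LinearIsometryEquiv.norm_map, sq]
    nlinarith [norm_nonneg K]
  refine ⟨1 / t - 1, ?_, ?_⟩
  · rw [Set.mem_Ici, le_sub_iff_add_le, le_div_iff₀ ht0]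
    nlinarith
  · have h1 : l + 1 = (t : ℂ)⁻¹ := by rw [← hre, inv_inv]
    simp only [Complex.ofReal_sub, Complex.ofReal_div, Complex.ofReal_one]
    rw [one_div, ← h1]
    ring

/-- Weyl's criterion in weak form: approximate solutions `g` of `⟪v, g⟫ = (l + 1) ⟪P v, P g⟫`
for all `v`, normalized by `‖P g‖ = 1`, show that `l` lies in the spectrum. -/
theorem LinearPMap.mem_spectrumC_of_approx {A : H →ₗ.[ℂ] H} (P : G →L[ℂ] H)
    (hA : ∀ x y : H, (x, y) ∈ A.graph ↔ P (ContinuousLinearMap.adjoint P (x + y)) = x) {l : ℂ}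
    (h : ∀ ε > 0, ∃ g : G, ‖P g‖ = 1 ∧
      ∀ v, ‖⟪v, g⟫_ℂ - (l + 1) * ⟪P v, P g⟫_ℂ‖ ≤ ε * ‖v‖) :
    l ∈ A.spectrumC := by
  intro hl
  set K : H →L[ℂ] H := P ∘L ContinuousLinearMap.adjoint P with hK
  rw [LinearPMap.mem_resolventSetC_iff_isUnit (A := A) (K := K) (by simpa [hK] using hA)] at hl
  obtain ⟨B, -, hB⟩ := isUnit_iff_exists.1 hl
  set c : ℝ := ‖B‖ * ‖P‖ + 1 with hc
  have hc0 : 0 < c := by positivity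
  obtain ⟨g, hg1, hg2⟩ := h (1 / (2 * c)) (by positivity)
  set r := g - (l + 1) • ContinuousLinearMap.adjoint P (P g) with hr
  have hrn : ‖r‖ ≤ 1 / (2 * c) := by
    have h1 := hg2 r
    have h2 : ⟪r, g⟫_ℂ - (l + 1) * ⟪P r, P g⟫_ℂ = ⟪r, r⟫_ℂ := by
      nth_rw 4 [hr]
      rw [inner_sub_right, inner_smul_right, ContinuousLinearMap.adjoint_inner_right]
    rw [h2, inner_self_eq_norm_sq_to_K] at h1
    by_contra! hcon
    have h0 : 0 < ‖r‖ := lt_trans (by positivity) hcon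
    have h3 : ‖r‖ * ‖r‖ ≤ 1 / (2 * c) * ‖r‖ := by
      simpa [sq] using h1
    exact absurd (le_of_mul_le_mul_right h3 h0) (not_le.2 hcon)
  have h4 : P g = B (P r) := by
    have : P r = (1 - (l + 1) • K) (P g) := by simp [hr, hK]
    rw [this, ← mul_apply_eq_comp, hB]; simp
  have h5 : ‖P g‖ ≤ ‖B‖ * (‖P‖ * (1 / (2 * c))) := by
    rw [h4]
    exact B.le_opNorm_of_le (P.le_opNorm_of_le hrn)
  rw [hg1] at h5
  have h6 : ‖B‖ * (‖P‖ * (1 / (2 * c))) = (c - 1) / (2 * c) := by rw [hc]; ring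
  rw [h6, le_div_iff₀ (by positivity)] at h5
  linarith

end Abstract

/-! ### The form domain as a Hilbert space -/

namespace FracDirichlet

variable {E : Type*} [NormedAddCommGroup E] [InnerProductSpace ℝ E] [FiniteDimensional ℝ E]
  [MeasurableSpace E] [BorelSpace E]

/-- The function `b · 𝓕 u` for a real weight `b`; the function `fracSymbol s u` is the case of the
weight `ξ ↦ (2π‖ξ‖)ˢ`. -/
def weighted (b : E → ℝ) (u : L2 E) : E → ℂ := fun ξ ↦ (b ξ : ℂ) * (𝓕 u : L2 E) ξ

lemma weighted_add (b : E → ℝ) (u v : L2 E) :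
    weighted b (u + v) =ᵐ[volume] weighted b u + weighted b v := by
  have h : (𝓕 (u + v) : L2 E) = 𝓕 u + 𝓕 v := FourierTransform.fourier_add u v
  unfold weighted
  rw [h]
  filter_upwards [Lp.coeFn_add (𝓕 u : L2 E) (𝓕 v : L2 E)] with ξ hξ
  simp only [hξ, Pi.add_apply]
  ring

lemma weighted_smul (b : E → ℝ) (c : ℂ) (u : L2 E) :
    weighted b (c • u) =ᵐ[volume] c • weighted b u := by
  have h : (𝓕 (c • u) : L2 E) = c • 𝓕 u := FourierTransform.fourier_smul c u
  unfold weighted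
  rw [h]
  filter_upwards [Lp.coeFn_smul c (𝓕 u : L2 E)] with ξ hξ
  simp only [hξ, Pi.smul_apply, smul_eq_mul]
  ring

/-- The graph of `u ↦ b · 𝓕 u` over the functions in `L²` that vanish outside `closure Ω`. With the
norm of `L² × L²` this is the form domain of the weight `b`, with its form norm. -/
def formGraph (b : E → ℝ) (Ω : Set E) : Submodule ℂ (WithLp 2 (L2 E × L2 E)) where
  carrier := {p | p.snd =ᵐ[volume] weighted b p.fst ∧ ∀ᵐ x : E, x ∉ closure Ω → p.fst x = 0}
  add_mem' := by
    rintro p q ⟨hp, hp'⟩ ⟨hq, hq'⟩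
    constructor
    · filter_upwards [hp, hq, weighted_add b p.fst q.fst, Lp.coeFn_add p.snd q.snd]
        with x h1 h2 h3 h4
      simp only [WithLp.add_fst, WithLp.add_snd]
      rw [h3, h4, Pi.add_apply, Pi.add_apply, h1, h2]
    · filter_upwards [hp', hq', Lp.coeFn_add p.fst q.fst] with x h1 h2 h3 hx
      simp only [WithLp.add_fst]
      rw [h3, Pi.add_apply, h1 hx, h2 hx, add_zero]
  zero_mem' := by
    constructor
    · filter_upwards [weighted_smul b 0 (0 : L2 E), Lp.coeFn_zero ℂ 2 (volume : Measure E)]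
        with x h1 h2
      simp only [WithLp.zero_fst, WithLp.zero_snd]
      rw [zero_smul, zero_smul] at h1
      rw [h1, h2]
    · filter_upwards [Lp.coeFn_zero ℂ 2 (volume : Measure E)] with x h _
      exact h
  smul_mem' := by
    rintro c p ⟨hp, hp'⟩
    constructor
    · filter_upwards [hp, weighted_smul b c p.fst, Lp.coeFn_smul c p.snd] with x h1 h2 h3
      simp only [WithLp.smul_fst, WithLp.smul_snd]
      rw [h2, h3, Pi.smul_apply, Pi.smul_apply, h1]
    · filter_upwards [hp', Lp.coeFn_smul c p.fst] with x h1 h3 hx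
      simp only [WithLp.smul_fst]
      simp [h3, h1 hx]

/-- A sequence that converges in `L²` has a subsequence that converges almost everywhere. -/
lemma exists_subseq_tendsto_ae {u : ℕ → L2 E} {v : L2 E}
    (h : Filter.Tendsto u Filter.atTop (nhds v)) :
    ∃ φ : ℕ → ℕ, StrictMono φ ∧
      ∀ᵐ x : E, Filter.Tendsto (fun k ↦ u (φ k) x) Filter.atTop (nhds (v x)) :=
  (tendstoInMeasure_of_tendsto_Lp h).exists_seq_tendsto_ae

lemma isClosed_formGraph (b : E → ℝ) (Ω : Set E) :
    IsClosed (formGraph b Ω : Set (WithLp 2 (L2 E × L2 E))) := by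
  refine isClosed_of_closure_subset fun p hp ↦ ?_
  obtain ⟨q, hq, hlim⟩ := mem_closure_iff_seq_limit.1 hp
  have hfst : Filter.Tendsto (fun k ↦ (q k).fst) Filter.atTop (nhds p.fst) :=
    ((WithLp.continuous_fst 2 _ _).tendsto p).comp hlim
  have hsnd : Filter.Tendsto (fun k ↦ (q k).snd) Filter.atTop (nhds p.snd) :=
    ((WithLp.continuous_snd 2 _ _).tendsto p).comp hlim
  have hF : Filter.Tendsto (fun k ↦ (𝓕 (q k).fst : L2 E)) Filter.atTop (nhds (𝓕 p.fst)) :=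
    ((Lp.fourierTransformₗᵢ E ℂ).continuous.tendsto p.fst).comp hfst
  constructor
  · obtain ⟨φ, hφ, h1⟩ := exists_subseq_tendsto_ae hsnd
    obtain ⟨ψ, hψ, h2⟩ := exists_subseq_tendsto_ae (hF.comp hφ.tendsto_atTop)
    have hq' : ∀ᵐ x : E, ∀ k, (q k).snd x = weighted b (q k).fst x :=
      ae_all_iff.2 fun k ↦ (hq k).1
    filter_upwards [h1, h2, hq'] with x h1 h2 hq'
    refine tendsto_nhds_unique (h1.comp hψ.tendsto_atTop) ?_
    simpa [weighted, hq', Function.comp_def] using h2.const_mul (b x : ℂ)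
  · obtain ⟨φ, hφ, h1⟩ := exists_subseq_tendsto_ae hfst
    have hq' : ∀ᵐ x : E, ∀ k, x ∉ closure Ω → (q k).fst x = 0 :=
      ae_all_iff.2 fun k ↦ (hq k).2
    filter_upwards [h1, hq'] with x h1 hq' hx
    refine tendsto_nhds_unique h1 ?_
    simp [hq' _ hx]

instance (b : E → ℝ) (Ω : Set E) : CompleteSpace (formGraph b Ω) :=
  (isClosed_formGraph b Ω).completeSpace_coe

/-- The embedding of the form domain of the weight `b` into `L²`. -/
def formFst (b : E → ℝ) (Ω : Set E) : formGraph b Ω →L[ℂ] L2 E :=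
  WithLp.fstL 2 ℂ (L2 E) (L2 E) ∘L (formGraph b Ω).subtypeL

@[simp] lemma formFst_apply (b : E → ℝ) (Ω : Set E) (g : formGraph b Ω) :
    formFst b Ω g = (g : WithLp 2 (L2 E × L2 E)).fst := rfl

/-- The element of the form domain of the weight `b` given by a function `u`. -/
def formMk {b : E → ℝ} {Ω : Set E} (u : L2 E) (h : MemLp (weighted b u) 2 volume)
    (hu : ∀ᵐ x : E, x ∉ closure Ω → u x = 0) : formGraph b Ω :=
  ⟨WithLp.toLp 2 (u, h.toLp _), h.coeFn_toLp, hu⟩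

lemma memLp_weighted_of_mem {b : E → ℝ} {Ω : Set E} (g : formGraph b Ω) :
    MemLp (weighted b (formFst b Ω g)) 2 volume :=
  (memLp_congr_ae g.2.1).1 (Lp.memLp _)

lemma inner_formGraph {b : E → ℝ} {Ω : Set E} (v g : formGraph b Ω) :
    ⟪v, g⟫_ℂ = ⟪formFst b Ω v, formFst b Ω g⟫_ℂ +
      ∫ ξ, ⟪weighted b (formFst b Ω v) ξ, weighted b (formFst b Ω g) ξ⟫_ℂ := by
  rw [Submodule.coe_inner, WithLp.prod_inner_apply]
  congr 1
  rw [L2.inner_def]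
  refine integral_congr_ae ?_
  filter_upwards [v.2.1, g.2.1] with ξ h1 h2
  simp only [formFst_apply]
  rw [← h1, ← h2]
  rfl

/-- The weight of the fractional Laplacian. -/
def fracWeight (s : ℝ) (ξ : E) : ℝ := (2 * Real.pi * ‖ξ‖) ^ s

lemma formFst_mem_formDomain (s : ℝ) (Ω : Set E) (g : formGraph (fracWeight s) Ω) :
    formFst (fracWeight s) Ω g ∈ formDomain s Ω :=
  ⟨memLp_weighted_of_mem g, g.2.2⟩

/-- The embedding of the form domain into the state space. -/
def formEmbedding (s : ℝ) (Ω : Set E) : formGraph (fracWeight s) Ω →L[ℂ] stateSpace s Ω :=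
  (formFst (fracWeight s) Ω).codRestrict (stateSpace s Ω) fun g ↦
    Submodule.le_topologicalClosure _ (formFst_mem_formDomain s Ω g)

@[simp] lemma coe_formEmbedding (s : ℝ) (Ω : Set E) (g : formGraph (fracWeight s) Ω) :
    (formEmbedding s Ω g : L2 E) = formFst (fracWeight s) Ω g := rfl

instance (s : ℝ) (Ω : Set E) : CompleteSpace (stateSpace s Ω) :=
  (formDomain s Ω).isClosed_topologicalClosure.completeSpace_coe

/-- With `P` the embedding of the form domain into the state space, `(A_s + 1)⁻¹ = P P†`. -/
theorem mem_operator_graph_iff (s : ℝ) (Ω : Set E) (x y : stateSpace s Ω) :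
    (x, y) ∈ (operator s Ω).graph ↔
      formEmbedding s Ω (ContinuousLinearMap.adjoint (formEmbedding s Ω) (x + y)) = x := by
  rw [operator_graph]
  constructor
  · rintro ⟨hx, h⟩
    set g : formGraph (fracWeight s) Ω := formMk x hx.1 hx.2
    have hg : ContinuousLinearMap.adjoint (formEmbedding s Ω) (x + y) = g := by
      refine ext_inner_left ℂ fun v ↦ ?_
      rw [ContinuousLinearMap.adjoint_inner_right, inner_formGraph, Submodule.coe_inner,
        coe_formEmbedding, Submodule.coe_add, inner_add_right,
        ← h _ (formFst_mem_formDomain s Ω v)]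
      rfl
    rw [hg]
    rfl
  · intro h
    set g := ContinuousLinearMap.adjoint (formEmbedding s Ω) (x + y) with hg
    have hgx : formFst (fracWeight s) Ω g = x := congrArg Subtype.val h
    refine ⟨?_, fun v hv ↦ ?_⟩
    · simp only
      rw [← hgx]
      exact formFst_mem_formDomain s Ω g
    · set v' : formGraph (fracWeight s) Ω := formMk v hv.1 hv.2
      have h1 := ContinuousLinearMap.adjoint_inner_right (formEmbedding s Ω) v' (x + y)
      rw [← hg, inner_formGraph, Submodule.coe_inner, coe_formEmbedding, Submodule.coe_add,
        inner_add_right, hgx] at h1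
      exact add_left_cancel h1

end FracDirichlet

/-! ### The Fourier transform of integrable functions and the weights -/

namespace FracDirichlet

variable {E : Type*} [NormedAddCommGroup E] [InnerProductSpace ℝ E] [FiniteDimensional ℝ E]
  [MeasurableSpace E] [BorelSpace E]

lemma continuous_fourier_of_integrable {f : E → ℂ} (hf : Integrable f volume) :
    Continuous fun ξ ↦ 𝓕 f ξ :=
  VectorFourier.fourierIntegral_continuous Real.continuous_fourierChar
    (by exact continuous_inner) hf

/-- On integrable elements of `L²` the Fourier transform of `L²` is given by the Fourier integral. -/
theorem fourier_ae_eq_of_integrable (u : L2 E) (hu : Integrable u volume) :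
    (𝓕 u : L2 E) =ᵐ[volume] fun ξ ↦ 𝓕 (u : E → ℂ) ξ := by
  refine ae_eq_of_integral_contDiff_smul_eq
    ((Lp.memLp (𝓕 u : L2 E)).locallyIntegrable (by norm_num))
    (continuous_fourier_of_integrable hu).locallyIntegrable fun g hg hgc ↦ ?_
  have hgc' : HasCompactSupport fun x ↦ (g x : ℂ) := hgc.comp_left Complex.ofReal_zero
  set G := hgc'.toSchwartzMap (Complex.ofRealCLM.contDiff.comp hg) with hG
  have hGx : ∀ x, G x = (g x : ℂ) := fun x ↦ rfl
  have h1 := congrArg (fun T ↦ T G) (Lp.fourier_toTemperedDistribution_eq u)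
  simp only [TemperedDistribution.fourier_apply, Lp.toTemperedDistribution_apply] at h1
  have h2 := VectorFourier.integral_fourierIntegral_smul_eq_flip (μ := (volume : Measure E))
    (ν := (volume : Measure E)) (L := innerₗ E) (f := (G : E → ℂ)) (g := (u : E → ℂ))
    Real.continuous_fourierChar (by exact continuous_inner) G.integrable hu
  have h3 : ∫ x, g x • (𝓕 u : L2 E) x = ∫ x, (𝓕 G) x • u x := by
    rw [h1]
    simp only [hGx, Complex.real_smul, smul_eq_mul]
  rw [h3, SchwartzMap.fourier_coe]
  refine h2.trans ?_
  refine integral_congr_ae (.of_forall fun x ↦ ?_)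
  simp only [hGx, Complex.real_smul, smul_eq_mul, flip_innerₗ]
  rfl

lemma enorm_sq_eq_lintegral (u : L2 E) : ‖u‖ₑ ^ 2 = ∫⁻ x, ‖u x‖ₑ ^ 2 := by
  rw [Lp.enorm_def, eLpNorm_eq_lintegral_rpow_enorm_toReal (by norm_num) (by norm_num)]
  simp only [ENNReal.toReal_ofNat, one_div, ENNReal.rpow_ofNat]
  rw [← ENNReal.rpow_natCast, ← ENNReal.rpow_mul]
  norm_num

lemma memLp_two_iff_lintegral {α : Type*} [MeasurableSpace α] {μ : Measure α} {f : α → ℂ}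
    (hf : AEStronglyMeasurable f μ) : MemLp f 2 μ ↔ ∫⁻ x, ‖f x‖ₑ ^ 2 ∂μ < ⊤ := by
  have h := eLpNorm_lt_top_iff_lintegral_rpow_enorm_lt_top (f := f) (μ := μ) (p := 2)
    two_ne_zero ENNReal.ofNat_ne_top
  simp only [ENNReal.toReal_ofNat, ENNReal.rpow_ofNat] at h
  exact ⟨fun H ↦ h.1 H.2, fun H ↦ ⟨hf, h.2 H⟩⟩

/-- The weight of the fractional Laplacian on `E × ℝ`, with the last frequency `η` frozen. -/
def weight (s η : ℝ) (ξ : E) : ℝ :=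
  (2 * Real.pi * ‖(WithLp.toLp 2 (ξ, η) : WithLp 2 (E × ℝ))‖) ^ s

lemma weight_nonneg (s η : ℝ) (ξ : E) : 0 ≤ weight s η ξ := by
  unfold weight; positivity

lemma weight_zero (s : ℝ) (ξ : E) : weight s 0 ξ = fracWeight s ξ := by
  unfold weight fracWeight
  rw [WithLp.norm_toLp_fst]

lemma continuous_weight {s : ℝ} (hs : 0 ≤ s) :
    Continuous fun p : E × ℝ ↦ weight s p.2 p.1 := by
  unfold weight
  exact (continuous_const.mul (WithLp.prod_continuous_toLp 2 E ℝ).norm).rpow_const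
    fun _ ↦ Or.inr hs

lemma continuous_weight_left {s : ℝ} (hs : 0 ≤ s) (η : ℝ) :
    Continuous fun ξ : E ↦ weight s η ξ :=
  (continuous_weight hs).comp (g := fun p : E × ℝ ↦ weight s p.2 p.1)
    (f := fun ξ : E ↦ (ξ, η)) (continuous_id.prodMk continuous_const)

lemma continuous_fracWeight {s : ℝ} (hs : 0 ≤ s) : Continuous (fracWeight s : E → ℝ) := by
  unfold fracWeight
  exact (continuous_const.mul continuous_norm).rpow_const fun _ ↦ Or.inr hs

lemma norm_le_norm_toLp (ξ : E) (η : ℝ) :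
    ‖ξ‖ ≤ ‖(WithLp.toLp 2 (ξ, η) : WithLp 2 (E × ℝ))‖ :=
  WithLp.norm_fst_le _ (WithLp.toLp 2 (ξ, η) : WithLp 2 (E × ℝ))

lemma fracWeight_le_weight {s : ℝ} (hs : 0 ≤ s) (η : ℝ) (ξ : E) :
    fracWeight s ξ ≤ weight s η ξ := by
  unfold weight fracWeight
  have := norm_le_norm_toLp ξ η
  gcongr

lemma fracWeight_le_weight' {s : ℝ} (hs : 0 ≤ s) (η : ℝ) (ξ : E) :
    fracWeight s η ≤ weight s η ξ := by
  unfold weight fracWeight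
  have : ‖η‖ ≤ ‖(WithLp.toLp 2 (ξ, η) : WithLp 2 (E × ℝ))‖ :=
    WithLp.norm_snd_le _ (WithLp.toLp 2 (ξ, η) : WithLp 2 (E × ℝ))
  gcongr

/-- As `s ≤ 1`, the function `r ↦ rˢ` is subadditive; this makes the weight Hölder continuous in
the frozen frequency. -/
lemma weight_le_add {s : ℝ} (hs : 0 ≤ s) (hs1 : s ≤ 1) (η η' : ℝ) (ξ : E) :
    weight s η ξ ≤ weight s η' ξ + fracWeight s (η - η') := by
  unfold weight fracWeight
  have h : ‖(WithLp.toLp 2 (ξ, η) : WithLp 2 (E × ℝ))‖ ≤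
      ‖(WithLp.toLp 2 (ξ, η') : WithLp 2 (E × ℝ))‖ + ‖η - η'‖ := by
    have h1 : (WithLp.toLp 2 (ξ, η) : WithLp 2 (E × ℝ)) =
        WithLp.toLp 2 (ξ, η') + WithLp.toLp 2 (0, η - η') := by
      rw [← WithLp.toLp_add]; simp
    rw [h1]
    refine (norm_add_le _ _).trans ?_
    rw [WithLp.norm_toLp_snd]
  calc _ ≤ (2 * Real.pi * ‖(WithLp.toLp 2 (ξ, η') : WithLp 2 (E × ℝ))‖ +
        2 * Real.pi * ‖η - η'‖) ^ s := by
        rw [← mul_add]; gcongr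
    _ ≤ _ := Real.rpow_add_le_add_rpow (by positivity) (by positivity) hs hs1

lemma abs_weight_sub_le {s : ℝ} (hs : 0 ≤ s) (hs1 : s ≤ 1) (η η' : ℝ) (ξ : E) :
    |weight s η ξ - weight s η' ξ| ≤ fracWeight s (η - η') := by
  rw [abs_le]
  constructor
  · have h := weight_le_add hs hs1 η' η ξ
    have h2 : fracWeight s (η' - η) = fracWeight s (η - η') := by
      unfold fracWeight; rw [norm_sub_rev]
    linarith
  · linarith [weight_le_add hs hs1 η η' ξ]

lemma fracWeight_le_one_add {s : ℝ} (hs : 0 ≤ s) (hs1 : s ≤ 1) (ξ : E) :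
    fracWeight s ξ ≤ 1 + 2 * Real.pi * ‖ξ‖ := by
  unfold fracWeight
  calc _ ≤ (1 + 2 * Real.pi * ‖ξ‖) ^ s := by gcongr; linarith
    _ ≤ (1 + 2 * Real.pi * ‖ξ‖) ^ (1 : ℝ) :=
        Real.rpow_le_rpow_of_exponent_le (by have := Real.pi_pos; nlinarith [norm_nonneg ξ]) hs1
    _ = _ := Real.rpow_one _

lemma memLp_fracWeight_mul_schwartz {s : ℝ} (hs : 0 ≤ s) (hs1 : s ≤ 1) (f : SchwartzMap E ℂ) :
    MemLp (fun ξ ↦ (fracWeight s ξ : ℂ) * f ξ) 2 volume := by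
  have hn : MemLp (fun ξ : E ↦ ((1 + 2 * Real.pi * ‖ξ‖ : ℝ) : ℂ) * f ξ) 2 volume := by
    have h0 := f.memLp 2 volume
    have h1 : MemLp (fun ξ : E ↦ ((‖ξ‖ : ℝ) : ℂ) * f ξ) 2 volume := by
      have hm : AEStronglyMeasurable (fun ξ : E ↦ ((‖ξ‖ : ℝ) : ℂ) * f ξ) volume :=
        ((Complex.continuous_ofReal.comp continuous_norm).mul f.continuous).aestronglyMeasurable
      rw [memLp_two_iff_integrable_sq_norm hm]
      obtain ⟨C, -, hC⟩ := f.decay 0 0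
      refine ((f.integrable_pow_mul volume 2).const_mul C).mono' (by fun_prop)
        (.of_forall fun ξ ↦ ?_)
      have h2 : ‖f ξ‖ ≤ C := by simpa using hC ξ
      simp only [norm_mul, Complex.norm_real, norm_norm, norm_pow]
      calc (‖ξ‖ * ‖f ξ‖) ^ 2 = ‖f ξ‖ * (‖ξ‖ ^ 2 * ‖f ξ‖) := by ring
        _ ≤ _ := by gcongr
    convert h0.add (h1.const_mul ((2 * Real.pi : ℝ) : ℂ)) using 1
    ext ξ
    simp only [Pi.add_apply]
    push_cast
    ring
  refine hn.mono (((Complex.continuous_ofReal.comp (continuous_fracWeight hs)).mul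
    f.continuous).aestronglyMeasurable) (.of_forall fun ξ ↦ ?_)
  rw [norm_mul, norm_mul, Complex.norm_real, Complex.norm_real,
    Real.norm_of_nonneg (by unfold fracWeight; positivity),
    Real.norm_of_nonneg (by positivity)]
  gcongr
  exact fracWeight_le_one_add hs hs1 ξ

end FracDirichlet

/-! ### Compactness over bounded sets -/

namespace FracDirichlet

variable {E : Type*} [NormedAddCommGroup E] [InnerProductSpace ℝ E] [FiniteDimensional ℝ E]
  [MeasurableSpace E] [BorelSpace E]

/-- Bounded sequences in `L²` have weakly convergent subsequences. -/
theorem exists_subseq_tendsto_inner (u : ℕ → L2 E) (hu : ∀ k, ‖u k‖ ≤ 1) :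
    ∃ φ : ℕ → ℕ, StrictMono φ ∧ ∀ w : L2 E, ∃ c : ℂ,
      Filter.Tendsto (fun k ↦ ⟪w, u (φ k)⟫_ℂ) Filter.atTop (nhds c) := by
  have hmem : ∀ k, StrongDual.toWeakDual (InnerProductSpace.toDual ℂ (L2 E) (u k)) ∈
      WeakDual.toStrongDual ⁻¹' Metric.closedBall (0 : StrongDual ℂ (L2 E)) 1 := by
    intro k
    simpa [mem_closedBall_zero_iff] using! hu k
  have : Fact ((2 : ENNReal) ≠ ⊤) := ⟨ENNReal.ofNat_ne_top⟩
  obtain ⟨F, -, φ, hφ, hlim⟩ := WeakDual.isSeqCompact_closedBall ℂ (L2 E) 0 1 hmem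
  refine ⟨φ, hφ, fun w ↦ ⟨starRingEnd ℂ (F w), ?_⟩⟩
  have h1 := ((WeakDual.eval_continuous w).tendsto F).comp hlim
  have h2 := (Complex.continuous_conj.tendsto _).comp h1
  refine h2.congr fun k ↦ ?_
  simp only [Function.comp_apply]
  rw [← inner_conj_symm w]
  rfl

lemma memLp_indicator_fourierChar {Ω : Set E} (hΩ : Bornology.IsBounded Ω) (ξ : E) :
    MemLp ((closure Ω).indicator fun x ↦ ((Real.fourierChar (inner ℝ x ξ) : Circle) : ℂ)) 2
      volume := by
  have hfin : volume (closure Ω) < ⊤ := (Metric.isBounded_closure_iff.2 hΩ).measure_lt_top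
  rw [memLp_indicator_iff_restrict isClosed_closure.measurableSet]
  have : IsFiniteMeasure (volume.restrict (closure Ω)) := ⟨by simpa using hfin⟩
  refine MemLp.of_bound (C := 1) ?_ (.of_forall fun x ↦ (Circle.norm_coe _).le)
  have : Continuous fun x : E ↦ ((Real.fourierChar (inner ℝ x ξ) : Circle) : ℂ) := by fun_prop
  exact this.aestronglyMeasurable

/-- A plane wave cut off to a bounded set. -/
def planeWave {Ω : Set E} (hΩ : Bornology.IsBounded Ω) (ξ : E) : L2 E :=
  (memLp_indicator_fourierChar hΩ ξ).toLp _

lemma integrable_of_ae_eq_zero {Ω : Set E} (hΩ : Bornology.IsBounded Ω) (u : L2 E)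
    (hu : ∀ᵐ x : E, x ∉ closure Ω → u x = 0) : Integrable u volume := by
  have h := (memLp_indicator_fourierChar hΩ 0).integrable_mul (Lp.memLp u)
  refine h.congr ?_
  filter_upwards [hu] with x hx
  by_cases hxΩ : x ∈ closure Ω
  · simp [hxΩ]
  · simp [hxΩ, hx hxΩ]

lemma fourier_eq_inner_planeWave {Ω : Set E} (hΩ : Bornology.IsBounded Ω) (u : L2 E)
    (hu : ∀ᵐ x : E, x ∉ closure Ω → u x = 0) (ξ : E) :
    𝓕 (u : E → ℂ) ξ = ⟪planeWave hΩ ξ, u⟫_ℂ := by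
  rw [Real.fourier_eq, L2.inner_def]
  refine integral_congr_ae ?_
  filter_upwards [hu, (memLp_indicator_fourierChar hΩ ξ).coeFn_toLp] with x hx h2
  unfold planeWave
  rw [h2]
  by_cases hxΩ : x ∈ closure Ω
  · rw [indicator_of_mem hxΩ, RCLike.inner_apply, AddChar.map_neg_eq_inv, Circle.smul_def,
      Circle.coe_inv_eq_conj, smul_eq_mul, mul_comm]
  · simp [hxΩ, hx hxΩ]

lemma norm_planeWave_le {Ω : Set E} (hΩ : Bornology.IsBounded Ω) (ξ : E) :
    ‖planeWave hΩ ξ‖ ≤ ‖planeWave hΩ (0 : E)‖ := by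
  unfold planeWave
  refine Lp.norm_le_norm_of_ae_le ?_
  filter_upwards [(memLp_indicator_fourierChar hΩ ξ).coeFn_toLp,
    (memLp_indicator_fourierChar hΩ 0).coeFn_toLp] with x h1 h2
  rw [h1, h2, norm_indicator_eq_indicator_norm, norm_indicator_eq_indicator_norm]
  refine indicator_le_indicator ?_
  rw [Circle.norm_coe, Circle.norm_coe]

lemma enorm_snd_formGraph_sq {b : E → ℝ} {Ω : Set E} (g : formGraph b Ω) :
    ‖(g : WithLp 2 (L2 E × L2 E)).snd‖ₑ ^ 2 = ∫⁻ ξ, ‖weighted b (formFst b Ω g) ξ‖ₑ ^ 2 := by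
  rw [enorm_sq_eq_lintegral]
  refine lintegral_congr_ae ?_
  filter_upwards [g.2.1] with ξ h
  rw [h]; rfl

/-- Rellich's theorem: over a bounded set the form domain embeds compactly into `L²`. The Fourier
transforms of a weakly convergent sequence converge pointwise and boundedly, so their differences
tend to zero in `L²` of a ball; outside the ball they are small because of the weight. -/
theorem exists_subseq_cauchySeq_formFst {s : ℝ} (hs : 0 < s) (η : ℝ) {Ω : Set E}
    (hΩ : Bornology.IsBounded Ω) (g : ℕ → formGraph (weight s η) Ω) (hg : ∀ k, ‖g k‖ ≤ 1) :
    ∃ φ : ℕ → ℕ, StrictMono φ ∧ CauchySeq fun k ↦ formFst (weight s η) Ω (g (φ k)) := by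
  set u : ℕ → L2 E := fun k ↦ formFst (weight s η) Ω (g k) with hu
  have hu1 : ∀ k, ‖u k‖ ≤ 1 := fun k ↦ (WithLp.norm_fst_le _ _).trans (hg k)
  obtain ⟨φ, hφ, hlim⟩ := exists_subseq_tendsto_inner u hu1
  refine ⟨φ, hφ, ?_⟩
  have hsupp : ∀ k, ∀ᵐ x : E, x ∉ closure Ω → u k x = 0 := fun k ↦ (g k).2.2
  set h : ℕ → E → ℂ := fun k ξ ↦ ⟪planeWave hΩ ξ, u (φ k)⟫_ℂ with hh
  have hF : ∀ k, (𝓕 (u (φ k)) : L2 E) =ᵐ[volume] h k := by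
    intro k
    filter_upwards [fourier_ae_eq_of_integrable (u (φ k))
      (integrable_of_ae_eq_zero hΩ _ (hsupp _))] with ξ h1
    rw [h1, fourier_eq_inner_planeWave hΩ _ (hsupp _)]
  set M : ℝ := ‖planeWave hΩ (0 : E)‖ with hM
  have hbound : ∀ k ξ, ‖h k ξ‖ ≤ M := by
    intro k ξ
    refine (norm_inner_le_norm _ _).trans ?_
    calc _ ≤ M * 1 := mul_le_mul (norm_planeWave_le hΩ ξ) (hu1 _) (norm_nonneg _) (norm_nonneg _)
      _ = M := mul_one M
  have hcont : ∀ k, Continuous (h k) := by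
    intro k
    have h1 : h k = fun ξ ↦ 𝓕 (u (φ k) : E → ℂ) ξ :=
      funext fun ξ ↦ (fourier_eq_inner_planeWave hΩ _ (hsupp _) ξ).symm
    rw [h1]
    exact continuous_fourier_of_integrable (integrable_of_ae_eq_zero hΩ _ (hsupp _))
  have hFsub : ∀ k l, (𝓕 (u (φ k) - u (φ l)) : L2 E) =ᵐ[volume] fun ξ ↦ h k ξ - h l ξ := by
    intro k l
    have h1 : (𝓕 (u (φ k) - u (φ l)) : L2 E) = 𝓕 (u (φ k)) - 𝓕 (u (φ l)) :=
      (Lp.fourierTransformₗᵢ E ℂ).map_sub _ _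
    rw [h1]
    filter_upwards [hF k, hF l, Lp.coeFn_sub (𝓕 (u (φ k)) : L2 E) (𝓕 (u (φ l)))] with ξ h2 h3 h4
    rw [h4, Pi.sub_apply, h2, h3]
  -- low frequencies
  have hball : ∀ R : ℝ, Filter.Tendsto
      (fun p : ℕ × ℕ ↦ ∫⁻ ξ in Metric.ball (0 : E) R, ‖h p.1 ξ - h p.2 ξ‖ₑ ^ 2)
      Filter.atTop (nhds 0) := by
    intro R
    have hz : (0 : ENNReal) = ∫⁻ ξ in Metric.ball (0 : E) R, 0 := by simp
    rw [hz]
    refine tendsto_lintegral_filter_of_dominated_convergence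
      (fun _ ↦ ENNReal.ofReal (2 * M) ^ 2) ?_ ?_ ?_ ?_
    · exact .of_forall fun p ↦ (((hcont p.1).sub (hcont p.2)).measurable.enorm.pow_const 2)
    · refine .of_forall fun p ↦ .of_forall fun ξ ↦ ?_
      gcongr
      rw [← ofReal_norm]
      apply ENNReal.ofReal_le_ofReal
      exact (norm_sub_le _ _).trans (by linarith [hbound p.1 ξ, hbound p.2 ξ])
    · rw [lintegral_const]
      exact ENNReal.mul_ne_top (ENNReal.pow_ne_top ENNReal.ofReal_ne_top) (by
        rw [Measure.restrict_apply_univ]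
        exact measure_ball_lt_top.ne)
    · refine .of_forall fun ξ ↦ ?_
      obtain ⟨c, hc⟩ := hlim (planeWave hΩ ξ)
      have h1 : Filter.Tendsto (fun p : ℕ × ℕ ↦ h p.1 ξ - h p.2 ξ) Filter.atTop
          (nhds (c - c)) := by
        rw [← Filter.prod_atTop_atTop_eq]
        exact (hc.comp Filter.tendsto_fst).sub (hc.comp Filter.tendsto_snd)
      rw [sub_self] at h1
      have h2 := ENNReal.Tendsto.pow (n := 2) h1.enorm
      simpa using h2
  -- high frequencies
  have htail : ∀ R : ℝ, 0 < R → ∀ k l,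
      ∫⁻ ξ in (Metric.ball (0 : E) R)ᶜ, ‖h k ξ - h l ξ‖ₑ ^ 2 ≤
        ENNReal.ofReal (4 / ((2 * Real.pi * R) ^ s) ^ 2) := by
    intro R hR k l
    set ρ : ℝ := (2 * Real.pi * R) ^ s with hρ
    have hρ0 : 0 < ρ := by positivity
    have h1 := enorm_snd_formGraph_sq (g (φ k) - g (φ l))
    have h2 : ‖((g (φ k) - g (φ l) : formGraph (weight s η) Ω) :
        WithLp 2 (L2 E × L2 E)).snd‖ₑ ^ 2 ≤ ENNReal.ofReal 4 := by
      have h3 : ‖((g (φ k) - g (φ l) : formGraph (weight s η) Ω) :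
          WithLp 2 (L2 E × L2 E)).snd‖ ≤ 2 :=
        (WithLp.norm_snd_le _ _).trans ((norm_sub_le (g (φ k)) (g (φ l))).trans
          (by linarith [hg (φ k), hg (φ l)]))
      rw [← ofReal_norm, ← ENNReal.ofReal_pow (norm_nonneg _)]
      apply ENNReal.ofReal_le_ofReal
      nlinarith [norm_nonneg ((g (φ k) - g (φ l) : formGraph (weight s η) Ω) :
          WithLp 2 (L2 E × L2 E)).snd]
    rw [ENNReal.ofReal_div_of_pos (by positivity), ENNReal.le_div_iff_mul_le (by simp)
      (by simp)]
    refine le_trans ?_ (h1 ▸ h2)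
    rw [mul_comm, ← lintegral_const_mul' _ _ (by simp)]
    refine (setLIntegral_mono_ae' measurableSet_ball.compl ?_).trans (setLIntegral_le_lintegral _ _)
    filter_upwards [hFsub k l] with ξ h4 hξ
    have h5 : weighted (weight s η) (formFst (weight s η) Ω (g (φ k) - g (φ l))) ξ =
        (weight s η ξ : ℂ) * (h k ξ - h l ξ) := by
      unfold weighted
      rw [map_sub, h4]
    rw [h5, enorm_mul, mul_pow, ENNReal.ofReal_pow hρ0.le]
    gcongr
    rw [← ofReal_norm, Complex.norm_real, Real.norm_of_nonneg (weight_nonneg _ _ _)]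
    apply ENNReal.ofReal_le_ofReal
    refine le_trans ?_ (fracWeight_le_weight hs.le η ξ)
    have h6 : R ≤ ‖ξ‖ := by simpa using hξ
    unfold fracWeight
    rw [hρ]
    gcongr
  rw [cauchySeq_iff_tendsto_dist_atTop_0, Metric.tendsto_nhds]
  intro ε hε
  -- the radius `R` for which `(2πR)ˢ = 4 / ε`
  set R : ℝ := (4 / ε) ^ s⁻¹ / (2 * Real.pi) with hR
  have hR0 : 0 < R := by positivity
  have hRs : (2 * Real.pi * R) ^ s = 4 / ε := by
    rw [hR, mul_div_cancel₀ _ (by positivity), Real.rpow_inv_rpow (by positivity) hs.ne']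
  filter_upwards [(hball R).eventually_lt_const
    (u := ENNReal.ofReal (ε ^ 2 / 2)) (ENNReal.ofReal_pos.2 (by positivity))] with p hp
  have h1 : ‖u (φ p.1) - u (φ p.2)‖ₑ ^ 2 < ENNReal.ofReal (ε ^ 2) := by
    have h2 : ‖u (φ p.1) - u (φ p.2)‖ₑ = ‖(𝓕 (u (φ p.1) - u (φ p.2)) : L2 E)‖ₑ := by
      rw [← ofReal_norm, ← ofReal_norm, Lp.norm_fourier_eq]
    rw [h2, enorm_sq_eq_lintegral,
      ← lintegral_add_compl _ (measurableSet_ball (x := (0 : E)) (ε := R))]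
    have h3 : ENNReal.ofReal (ε ^ 2) = ENNReal.ofReal (ε ^ 2 / 2) + ENNReal.ofReal (ε ^ 2 / 2) := by
      rw [← ENNReal.ofReal_add (by positivity) (by positivity), add_halves]
    rw [h3]
    refine ENNReal.add_lt_add_of_lt_of_le ?_ ?_ ?_
    · refine ne_top_of_le_ne_top (b := ENNReal.ofReal (4 / ((2 * Real.pi * R) ^ s) ^ 2))
        ENNReal.ofReal_ne_top ((lintegral_congr_ae ?_).trans_le (htail R hR0 p.1 p.2))
      filter_upwards [ae_restrict_of_ae (hFsub p.1 p.2)] with ξ h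
      rw [h]
    · refine (lintegral_congr_ae ?_).trans_lt hp
      filter_upwards [ae_restrict_of_ae (hFsub p.1 p.2)] with ξ h
      rw [h]
    · refine ((lintegral_congr_ae ?_).trans_le (htail R hR0 p.1 p.2)).trans ?_
      · filter_upwards [ae_restrict_of_ae (hFsub p.1 p.2)] with ξ h
        rw [h]
      · apply ENNReal.ofReal_le_ofReal
        rw [hRs, div_pow, div_div_eq_mul_div, div_le_div_iff₀ (by norm_num) (by norm_num)]
        nlinarith [sq_nonneg ε]
  rw [← ofReal_norm, ← ENNReal.ofReal_pow (norm_nonneg _),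
    ENNReal.ofReal_lt_ofReal_iff (by positivity)] at h1
  have h4 := lt_of_pow_lt_pow_left₀ 2 hε.le h1
  rw [dist_zero_right, Real.norm_of_nonneg dist_nonneg, dist_eq_norm]
  exact h4

end FracDirichlet

/-! ### Ground states at a frozen frequency -/

namespace FracDirichlet

variable {E : Type*} [NormedAddCommGroup E] [InnerProductSpace ℝ E] [FiniteDimensional ℝ E]
  [MeasurableSpace E] [BorelSpace E]

/-- The component `b · 𝓕 u` of an element of the form domain. -/
abbrev formSnd {b : E → ℝ} {Ω : Set E} (g : formGraph b Ω) : L2 E :=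
  (g : WithLp 2 (L2 E × L2 E)).snd

lemma inner_formGraph' {b : E → ℝ} {Ω : Set E} (v g : formGraph b Ω) :
    ⟪v, g⟫_ℂ = ⟪formFst b Ω v, formFst b Ω g⟫_ℂ + ⟪formSnd v, formSnd g⟫_ℂ := rfl

lemma norm_sq_formGraph {b : E → ℝ} {Ω : Set E} (g : formGraph b Ω) :
    ‖g‖ ^ 2 = ‖formFst b Ω g‖ ^ 2 + ‖formSnd g‖ ^ 2 :=
  WithLp.prod_norm_sq_eq_of_L2 _

lemma exists_schwartz_tsupport_subset {Ω : Set E} (hΩ : IsOpen Ω) (hne : Ω.Nonempty) :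
    ∃ f : SchwartzMap E ℂ, f ≠ 0 ∧ ∀ x, x ∉ Ω → f x = 0 := by
  obtain ⟨x, hx⟩ := hne
  obtain ⟨f, hf1, hf2, hf3, -, hf5⟩ :=
    exists_contDiff_tsupport_subset (n := ⊤) (hΩ.mem_nhds hx)
  have hc : HasCompactSupport fun x ↦ (f x : ℂ) := hf2.comp_left Complex.ofReal_zero
  refine ⟨hc.toSchwartzMap (Complex.ofRealCLM.contDiff.comp hf3), fun h ↦ ?_, fun y hy ↦ ?_⟩
  · have : ((f x : ℝ) : ℂ) = 0 := DFunLike.congr_fun h x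
    rw [hf5] at this
    simp at this
  · have : f y = 0 := by
      by_contra h
      exact hy (hf1 (subset_tsupport _ h))
    change ((f y : ℝ) : ℂ) = 0
    rw [this, Complex.ofReal_zero]

lemma aestronglyMeasurable_weighted {b : E → ℝ} (hb : Continuous b) (u : L2 E) :
    AEStronglyMeasurable (weighted b u) volume :=
  (Complex.continuous_ofReal.comp hb).aestronglyMeasurable.mul (Lp.aestronglyMeasurable _)

/-- All the weights with a frozen frequency have the same form domain. -/
lemma memLp_weighted_weight {s : ℝ} (hs : 0 ≤ s) (hs1 : s ≤ 1) {η η' : ℝ} {u : L2 E}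
    (h : MemLp (weighted (weight s η') u) 2 volume) :
    MemLp (weighted (weight s η) u) 2 volume := by
  have h1 : MemLp (weighted (fun ξ ↦ weight s η' ξ + fracWeight s (η - η')) u) 2 volume := by
    convert h.add ((Lp.memLp (𝓕 u : L2 E)).const_mul ((fracWeight s (η - η') : ℝ) : ℂ)) using 1
    ext ξ
    simp only [weighted, Pi.add_apply]
    push_cast
    ring
  refine h1.mono (aestronglyMeasurable_weighted (continuous_weight_left hs η) u)
    (.of_forall fun ξ ↦ ?_)
  have h2 := weight_le_add hs hs1 η η' ξ
  have h3 := weight_nonneg s η ξ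
  simp only [weighted, norm_mul, Complex.norm_real]
  rw [Real.norm_of_nonneg h3, Real.norm_of_nonneg (h3.trans h2)]
  gcongr

lemma memLp_weighted_schwartz {s : ℝ} (hs : 0 ≤ s) (hs1 : s ≤ 1) (f : SchwartzMap E ℂ) :
    MemLp (weighted (weight s 0) (f.toLp 2 volume)) 2 volume := by
  refine (memLp_congr_ae ?_).1 (memLp_fracWeight_mul_schwartz hs hs1 (𝓕 f))
  have h2 : (𝓕 (f.toLp 2 volume : L2 E) : L2 E) = (𝓕 f).toLp 2 volume :=
    SchwartzMap.toLp_fourier_eq f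
  filter_upwards [(𝓕 f).coeFn_toLp 2 volume] with ξ h3
  unfold weighted
  rw [h2, h3, weight_zero]

lemma toLp_schwartz_ne_zero {f : SchwartzMap E ℂ} (hf : f ≠ 0) :
    (f.toLp 2 volume : L2 E) ≠ 0 := by
  intro h2
  apply hf
  have h3 : (f : E → ℂ) =ᵐ[volume] fun _ ↦ 0 := by
    filter_upwards [f.coeFn_toLp 2 volume, Lp.coeFn_zero ℂ 2 (volume : Measure E)] with x e1 e2
    rw [← e1, h2, e2]
    rfl
  have h4 := (f.continuous.ae_eq_iff_eq volume continuous_const).1 h3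
  ext x
  exact congrFun h4 x

lemma exists_formFst_ne_zero {s : ℝ} (hs : 0 ≤ s) (hs1 : s ≤ 1) (η : ℝ) {Ω : Set E}
    (hΩ : IsOpen Ω) (hne : Ω.Nonempty) :
    ∃ g : formGraph (weight s η) Ω, formFst (weight s η) Ω g ≠ 0 := by
  obtain ⟨f, hf0, hf⟩ := exists_schwartz_tsupport_subset hΩ hne
  have hu : ∀ᵐ x : E, x ∉ closure Ω → (f.toLp 2 volume : L2 E) x = 0 := by
    filter_upwards [f.coeFn_toLp 2 volume] with x hx hxΩ
    rw [hx, hf x fun h ↦ hxΩ (subset_closure h)]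
  have h1 : MemLp (weighted (weight s η) (f.toLp 2 volume)) 2 volume :=
    memLp_weighted_weight hs hs1 (memLp_weighted_schwartz hs hs1 f)
  have h0 := toLp_schwartz_ne_zero hf0
  generalize f.toLp 2 volume = u at hu h1 h0
  exact ⟨formMk u h1 hu, h0⟩

/-- `g` is a normalized ground state with energy `L`: it satisfies the Euler–Lagrange equation, and
`L` is a lower bound of the form. -/
structure IsGroundState {b : E → ℝ} {Ω : Set E} (g : formGraph b Ω) (L : ℝ) : Prop where
  norm_eq : ‖formFst b Ω g‖ = 1
  euler : ∀ v : formGraph b Ω, ⟪formSnd v, formSnd g⟫_ℂ = L * ⟪formFst b Ω v, formFst b Ω g⟫_ℂ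
  lower : ∀ v : formGraph b Ω, L * ‖formFst b Ω v‖ ^ 2 ≤ ‖formSnd v‖ ^ 2

lemma IsGroundState.norm_snd_sq {b : E → ℝ} {Ω : Set E} {g : formGraph b Ω} {L : ℝ}
    (h : IsGroundState g L) : ‖formSnd g‖ ^ 2 = L := by
  have h1 := h.euler g
  rw [inner_self_eq_norm_sq_to_K, inner_self_eq_norm_sq_to_K, h.norm_eq] at h1
  have h2 : ((‖formSnd g‖ ^ 2 : ℝ) : ℂ) = (L : ℂ) := by
    simpa using h1
  exact_mod_cast h2

lemma IsGroundState.nonneg {b : E → ℝ} {Ω : Set E} {g : formGraph b Ω} {L : ℝ}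
    (h : IsGroundState g L) : 0 ≤ L := h.norm_snd_sq ▸ sq_nonneg _

lemma IsGroundState.norm_snd {b : E → ℝ} {Ω : Set E} {g : formGraph b Ω} {L : ℝ}
    (h : IsGroundState g L) : ‖formSnd g‖ = √L := by
  rw [← h.norm_snd_sq, Real.sqrt_sq (norm_nonneg _)]

/-- The compact embedding `P` of the form domain into `L²` attains its norm, and a maximizer is a
ground state with energy `‖P‖⁻² - 1`, because the squared
form norm is the sum of the energy and the squared `L²` norm. -/
theorem exists_isGroundState {s : ℝ} (hs : 0 < s) (hs1 : s ≤ 1) (η : ℝ) {Ω : Set E}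
    (hΩ : IsOpen Ω) (hne : Ω.Nonempty) (hbdd : Bornology.IsBounded Ω) :
    ∃ (L : ℝ) (g : formGraph (weight s η) Ω), IsGroundState g L := by
  set P := formFst (weight s η) Ω with hP
  have hP0 : P ≠ 0 := by
    obtain ⟨g, hg⟩ := exists_formFst_ne_zero hs.le hs1 η hΩ hne
    rintro h
    exact hg (by rw [← hP, h]; rfl)
  obtain ⟨g, hg0, hg⟩ := exists_adjoint_apply_eq_norm_sq_smul P hP0
    (exists_subseq_cauchySeq_formFst hs η hbdd)
  set κ : ℝ := ‖P‖ ^ 2 with hκ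
  have hκ0 : 0 < κ := by
    have := (norm_pos_iff (a := P)).2 hP0
    positivity
  have hκC : (κ : ℂ) ≠ 0 := by exact_mod_cast hκ0.ne'
  have hPg : P g ≠ 0 := by
    intro h
    rw [h, map_zero] at hg
    exact smul_ne_zero hκC hg0 hg.symm
  have hn : ‖P g‖ ≠ 0 := norm_ne_zero_iff.2 hPg
  have key : ∀ v : formGraph (weight s η) Ω,
      ⟪formSnd v, formSnd g⟫_ℂ = ((1 / κ - 1 : ℝ) : ℂ) * ⟪P v, P g⟫_ℂ := by
    intro v
    have h1 := ContinuousLinearMap.adjoint_inner_right P v (P g)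
    rw [hg, inner_smul_right, inner_formGraph'] at h1
    rw [← hP] at h1
    push_cast
    field_simp
    linear_combination h1
  refine ⟨1 / κ - 1, ((‖P g‖ : ℂ))⁻¹ • g, ?_, fun v ↦ ?_, fun v ↦ ?_⟩
  · rw [← hP, map_smul, norm_smul, norm_inv, Complex.norm_real, norm_norm, inv_mul_cancel₀ hn]
  · have h1 : formSnd (((‖P g‖ : ℂ))⁻¹ • g) = ((‖P g‖ : ℂ))⁻¹ • formSnd g := rfl
    rw [← hP, map_smul, inner_smul_right, h1, inner_smul_right, key]
    ring
  · have h1 : ‖P v‖ ^ 2 ≤ κ * ‖v‖ ^ 2 := by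
      rw [hκ, ← mul_pow]
      gcongr
      exact P.le_opNorm v
    rw [norm_sq_formGraph, ← hP] at h1
    rw [← hP, sub_mul, one_mul, div_mul_eq_mul_div, one_mul, sub_le_iff_le_add, div_le_iff₀ hκ0]
    linarith

/-- The energies of the ground states are Hölder continuous in the frozen frequency. -/
lemma IsGroundState.sqrt_le_add {s : ℝ} (hs : 0 ≤ s) (hs1 : s ≤ 1) {η η' : ℝ} {Ω : Set E}
    {g : formGraph (weight s η) Ω} {g' : formGraph (weight s η') Ω} {L L' : ℝ}
    (h : IsGroundState g L) (h' : IsGroundState g' L') :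
    √L' ≤ √L + fracWeight s (η - η') := by
  set u : L2 E := formFst (weight s η) Ω g with hu
  set w : formGraph (weight s η') Ω :=
    formMk u (memLp_weighted_weight hs hs1 (memLp_weighted_of_mem g)) g.2.2 with hw
  have hw1 : formFst (weight s η') Ω w = u := rfl
  have h1 : √L' ≤ ‖formSnd w‖ := by
    rw [← Real.sqrt_sq (norm_nonneg (formSnd w))]
    apply Real.sqrt_le_sqrt
    have h2 := h'.lower w
    rwa [hw1, hu, h.norm_eq, one_pow, mul_one] at h2
  have h3 : ‖formSnd w - formSnd g‖ ≤ fracWeight s (η - η') * ‖(𝓕 u : L2 E)‖ := by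
    refine Lp.norm_le_mul_norm_of_ae_le_mul ?_
    filter_upwards [Lp.coeFn_sub (formSnd w) (formSnd g), w.2.1, g.2.1] with ξ e1 e2 e3
    rw [e1, Pi.sub_apply, e2, e3]
    change ‖(weight s η' ξ : ℂ) * (𝓕 u : L2 E) ξ - (weight s η ξ : ℂ) * (𝓕 u : L2 E) ξ‖ ≤ _
    rw [← sub_mul, norm_mul, ← Complex.ofReal_sub, Complex.norm_real, Real.norm_eq_abs,
      abs_sub_comm]
    gcongr
    exact abs_weight_sub_le hs hs1 η η' ξ
  rw [Lp.norm_fourier_eq, hu, h.norm_eq, mul_one] at h3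
  rw [← h.norm_snd]
  linarith [norm_le_norm_add_norm_sub' (formSnd w) (formSnd g)]

lemma IsGroundState.fracWeight_le_sqrt {s : ℝ} (hs : 0 ≤ s) {η : ℝ} {Ω : Set E}
    {g : formGraph (weight s η) Ω} {L : ℝ} (h : IsGroundState g L) :
    fracWeight s η ≤ √L := by
  set u : L2 E := formFst (weight s η) Ω g with hu
  have h0 : 0 ≤ fracWeight s η := by unfold fracWeight; positivity
  have h1 : ‖((fracWeight s η : ℝ) : ℂ) • (𝓕 u : L2 E)‖ ≤ ‖formSnd g‖ := by
    refine Lp.norm_le_norm_of_ae_le ?_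
    filter_upwards [Lp.coeFn_smul ((fracWeight s η : ℝ) : ℂ) (𝓕 u : L2 E), g.2.1] with ξ e1 e2
    rw [e1, e2]
    change ‖((fracWeight s η : ℝ) : ℂ) * (𝓕 u : L2 E) ξ‖ ≤ ‖(weight s η ξ : ℂ) * (𝓕 u : L2 E) ξ‖
    rw [norm_mul, norm_mul, Complex.norm_real, Complex.norm_real, Real.norm_of_nonneg h0,
      Real.norm_of_nonneg (weight_nonneg _ _ _)]
    gcongr
    exact fracWeight_le_weight' hs η ξ
  rwa [norm_smul, Lp.norm_fourier_eq, hu, h.norm_eq, mul_one, Complex.norm_real,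
    Real.norm_of_nonneg h0, h.norm_snd] at h1

/-- By the intermediate value theorem, every number above the ground state energy at frequency
zero is the ground state energy at some frequency. -/
theorem exists_isGroundState_of_le {s : ℝ} (hs : 0 < s) (hs1 : s ≤ 1) {Ω : Set E}
    (hΩ : IsOpen Ω) (hne : Ω.Nonempty) (hbdd : Bornology.IsBounded Ω)
    {g₀ : formGraph (weight s 0) Ω} {L₀ L : ℝ} (h₀ : IsGroundState g₀ L₀) (hL : L₀ ≤ L) :
    ∃ (η : ℝ) (g : formGraph (weight s η) Ω), IsGroundState g L := by
  choose M g hg using fun η : ℝ ↦ exists_isGroundState hs hs1 η hΩ hne hbdd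
  have hL0 : 0 ≤ L := h₀.nonneg.trans hL
  have hcont : Continuous fun η ↦ √(M η) := by
    refine continuous_iff_continuousAt.2 fun η ↦ ?_
    have h1 : Filter.Tendsto (fun η' ↦ fracWeight s (η' - η)) (nhds η) (nhds 0) := by
      have h2 : Continuous fun η' ↦ fracWeight s (η' - η) :=
        (continuous_fracWeight hs.le).comp (continuous_id.sub continuous_const)
      have h3 := h2.tendsto η
      have h4 : fracWeight s (0 : ℝ) = 0 := by
        unfold fracWeight; simp [hs.ne']
      rwa [sub_self, h4] at h3
    refine tendsto_iff_dist_tendsto_zero.2 (squeeze_zero (fun _ ↦ dist_nonneg) (fun η' ↦ ?_) h1)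
    rw [Real.dist_eq, abs_le]
    have e1 := (hg η).sqrt_le_add hs.le hs1 (hg η')
    have e2 := (hg η').sqrt_le_add hs.le hs1 (hg η)
    have e3 : fracWeight s (η - η') = fracWeight s (η' - η) := by
      unfold fracWeight; rw [norm_sub_rev]
    constructor <;> linarith
  have h1 : √(M 0) ≤ √L := by
    have e1 := h₀.sqrt_le_add hs.le hs1 (hg 0)
    have e4 : fracWeight s ((0 : ℝ) - 0) = 0 := by
      unfold fracWeight; simp [hs.ne']
    have e5 := Real.sqrt_le_sqrt hL
    linarith
  set η₁ : ℝ := √L ^ s⁻¹ / (2 * Real.pi) with hη₁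
  have hη₁0 : 0 ≤ η₁ := by positivity
  have h2 : √L ≤ √(M η₁) := by
    refine le_trans (le_of_eq ?_) ((hg η₁).fracWeight_le_sqrt hs.le)
    unfold fracWeight
    rw [Real.norm_of_nonneg hη₁0, hη₁, mul_div_cancel₀ _ (by positivity),
      Real.rpow_inv_rpow (by positivity) hs.ne']
  obtain ⟨η, hη⟩ := mem_range_of_exists_le_of_exists_ge hcont ⟨0, h1⟩ ⟨η₁, h2⟩
  refine ⟨η, g η, ?_⟩
  have h3 : M η = L := (Real.sqrt_inj (hg η).nonneg hL0).1 hη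
  exact h3 ▸ hg η

end FracDirichlet

namespace FracDirichlet

variable {E : Type*} [NormedAddCommGroup E] [InnerProductSpace ℝ E] [FiniteDimensional ℝ E]
  [MeasurableSpace E] [BorelSpace E]
variable {F : Type*} [NormedAddCommGroup F] [InnerProductSpace ℝ F] [FiniteDimensional ℝ F]
  [MeasurableSpace F] [BorelSpace F]

/-! ### Integration over an orthogonal product -/

lemma quasiMeasurePreserving_fst :
    Measure.QuasiMeasurePreserving (fun x : WithLp 2 (E × F) ↦ x.fst) volume volume :=
  Measure.quasiMeasurePreserving_fst.comp
    (WithLp.volume_preserving_ofLp E F).quasiMeasurePreserving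

lemma quasiMeasurePreserving_snd :
    Measure.QuasiMeasurePreserving (fun x : WithLp 2 (E × F) ↦ x.snd) volume volume :=
  Measure.quasiMeasurePreserving_snd.comp
    (WithLp.volume_preserving_ofLp E F).quasiMeasurePreserving

lemma ae_prod_of_ae {p : WithLp 2 (E × F) → Prop} (h : ∀ᵐ x, p x) :
    ∀ᵐ a : E, ∀ᵐ b : F, p (WithLp.toLp 2 (a, b)) :=
  Measure.ae_ae_of_ae_prod ((WithLp.volume_preserving_toLp E F).quasiMeasurePreserving.ae h)

lemma lintegral_withLp {f : WithLp 2 (E × F) → ENNReal} (hf : AEMeasurable f volume) :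
    ∫⁻ x, f x = ∫⁻ a : E, ∫⁻ b : F, f (WithLp.toLp 2 (a, b)) := by
  have h1 := WithLp.volume_preserving_toLp E F
  rw [← h1.map_eq] at hf ⊢
  rw [lintegral_map' hf h1.measurable.aemeasurable]
  exact lintegral_prod _ (hf.comp_measurable h1.measurable)

lemma measurableEmbedding_toLp : MeasurableEmbedding (@WithLp.toLp 2 (E × F)) :=
  (MeasurableEquiv.toLp 2 (E × F)).measurableEmbedding

lemma integrable_comp_toLp {f : WithLp 2 (E × F) → ℂ} (hf : Integrable f volume) :
    Integrable (fun p : E × F ↦ f (WithLp.toLp 2 p)) (volume.prod volume) :=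
  ((WithLp.volume_preserving_toLp E F).integrable_comp_emb measurableEmbedding_toLp).2 hf

lemma integral_withLp {f : WithLp 2 (E × F) → ℂ} (hf : Integrable f volume) :
    ∫ x, f x = ∫ a : E, ∫ b : F, f (WithLp.toLp 2 (a, b)) := by
  rw [← (WithLp.volume_preserving_toLp E F).integral_comp measurableEmbedding_toLp]
  exact integral_prod _ (integrable_comp_toLp hf)

lemma integral_withLp_mul (f : E → ℂ) (g : F → ℂ) :
    ∫ x : WithLp 2 (E × F), f x.fst * g x.snd = (∫ a, f a) * ∫ b, g b := by
  rw [← (WithLp.volume_preserving_toLp E F).integral_comp measurableEmbedding_toLp]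
  exact integral_prod_mul f g

lemma integrable_withLp_mul {f : E → ℂ} {g : F → ℂ} (hf : Integrable f volume)
    (hg : Integrable g volume) :
    Integrable (fun x : WithLp 2 (E × F) ↦ f x.fst * g x.snd) volume := by
  rw [← (WithLp.volume_preserving_toLp E F).integrable_comp_emb measurableEmbedding_toLp]
  exact hf.mul_prod hg

lemma aestronglyMeasurable_tensor {f : E → ℂ} {g : F → ℂ} (hf : AEStronglyMeasurable f volume)
    (hg : AEStronglyMeasurable g volume) :
    AEStronglyMeasurable (fun x : WithLp 2 (E × F) ↦ f x.fst * g x.snd) volume :=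
  (hf.comp_quasiMeasurePreserving quasiMeasurePreserving_fst).mul
    (hg.comp_quasiMeasurePreserving quasiMeasurePreserving_snd)

lemma lintegral_tensor_sq {f : E → ℂ} {g : F → ℂ} (hf : AEStronglyMeasurable f volume)
    (hg : AEStronglyMeasurable g volume) :
    ∫⁻ x : WithLp 2 (E × F), ‖f x.fst * g x.snd‖ₑ ^ 2 =
      (∫⁻ a, ‖f a‖ₑ ^ 2) * ∫⁻ b, ‖g b‖ₑ ^ 2 := by
  rw [lintegral_withLp ((aestronglyMeasurable_tensor hf hg).enorm.pow_const 2)]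
  simp only [enorm_mul, mul_pow]
  rw [← lintegral_mul_const'' _ (hf.enorm.pow_const 2)]
  refine lintegral_congr fun a ↦ ?_
  exact lintegral_const_mul'' (‖f a‖ₑ ^ 2) (hg.enorm.pow_const 2)

lemma memLp_tensor {f : E → ℂ} {g : F → ℂ} (hf : MemLp f 2 volume) (hg : MemLp g 2 volume) :
    MemLp (fun x : WithLp 2 (E × F) ↦ f x.fst * g x.snd) 2 volume := by
  rw [memLp_two_iff_lintegral (aestronglyMeasurable_tensor hf.1 hg.1),
    lintegral_tensor_sq hf.1 hg.1]
  exact ENNReal.mul_lt_top ((memLp_two_iff_lintegral hf.1).1 hf)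
    ((memLp_two_iff_lintegral hg.1).1 hg)

/-! ### Tensor products and partial inner products -/

/-- The function `(x, y) ↦ v x * φ y`. -/
def tensor (v : L2 E) (φ : L2 F) : L2 (WithLp 2 (E × F)) :=
  (memLp_tensor (Lp.memLp v) (Lp.memLp φ)).toLp _

lemma coeFn_tensor (v : L2 E) (φ : L2 F) :
    tensor v φ =ᵐ[volume] fun x : WithLp 2 (E × F) ↦ v x.fst * φ x.snd :=
  (memLp_tensor (Lp.memLp v) (Lp.memLp φ)).coeFn_toLp

lemma norm_tensor (v : L2 E) (φ : L2 F) : ‖tensor v φ‖ = ‖v‖ * ‖φ‖ := by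
  have h : ‖tensor v φ‖ₑ ^ 2 = (‖v‖ₑ * ‖φ‖ₑ) ^ 2 := by
    rw [mul_pow, enorm_sq_eq_lintegral, enorm_sq_eq_lintegral, enorm_sq_eq_lintegral,
      ← lintegral_tensor_sq (Lp.aestronglyMeasurable v) (Lp.aestronglyMeasurable φ)]
    refine lintegral_congr_ae ?_
    filter_upwards [coeFn_tensor v φ] with x hx
    rw [hx]
  rw [← ofReal_norm, ← ofReal_norm, ← ofReal_norm, ← ENNReal.ofReal_mul (norm_nonneg _),
    ← ENNReal.ofReal_pow (norm_nonneg _), ← ENNReal.ofReal_pow (by positivity),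
    ENNReal.ofReal_eq_ofReal_iff (by positivity) (by positivity)] at h
  exact (sq_eq_sq₀ (norm_nonneg _) (by positivity)).1 h

/-- The tensor product as a continuous linear map in the first factor. -/
def tensorLeft (φ : L2 F) : L2 E →L[ℂ] L2 (WithLp 2 (E × F)) :=
  LinearMap.mkContinuous
    { toFun := fun v ↦ tensor v φ
      map_add' := by
        intro v w
        apply Lp.ext
        filter_upwards [coeFn_tensor (v + w) φ, coeFn_tensor v φ, coeFn_tensor w φ,
          Lp.coeFn_add (tensor v φ) (tensor w φ),
          quasiMeasurePreserving_fst.ae (Lp.coeFn_add v w)] with x h1 h2 h3 h4 h5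
        rw [h1, h4, Pi.add_apply, h2, h3, h5, Pi.add_apply, add_mul]
      map_smul' := by
        intro c v
        apply Lp.ext
        filter_upwards [coeFn_tensor (c • v) φ, coeFn_tensor v φ,
          Lp.coeFn_smul c (tensor v φ),
          quasiMeasurePreserving_fst.ae (Lp.coeFn_smul c v)] with x h1 h2 h4 h5
        rw [RingHom.id_apply, h1, h4, Pi.smul_apply, h2, h5, Pi.smul_apply, smul_mul_assoc] }
    ‖φ‖ fun v ↦ by
      rw [mul_comm]
      exact (norm_tensor v φ).le

/-- The tensor product as a continuous linear map in the second factor. -/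
def tensorRight (v : L2 E) : L2 F →L[ℂ] L2 (WithLp 2 (E × F)) :=
  LinearMap.mkContinuous
    { toFun := fun φ ↦ tensor v φ
      map_add' := by
        intro φ ψ
        apply Lp.ext
        filter_upwards [coeFn_tensor v (φ + ψ), coeFn_tensor v φ, coeFn_tensor v ψ,
          Lp.coeFn_add (tensor v φ) (tensor v ψ),
          quasiMeasurePreserving_snd.ae (Lp.coeFn_add φ ψ)] with x h1 h2 h3 h4 h5
        rw [h1, h4, Pi.add_apply, h2, h3, h5, Pi.add_apply, mul_add]
      map_smul' := by
        intro c φ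
        apply Lp.ext
        filter_upwards [coeFn_tensor v (c • φ), coeFn_tensor v φ,
          Lp.coeFn_smul c (tensor v φ),
          quasiMeasurePreserving_snd.ae (Lp.coeFn_smul c φ)] with x h1 h2 h4 h5
        rw [RingHom.id_apply, h1, h4, Pi.smul_apply, h2, h5, Pi.smul_apply, mul_smul_comm] }
    ‖v‖ fun φ ↦ (norm_tensor v φ).le

lemma fourier_tensor_schwartz (f : SchwartzMap E ℂ) (g : SchwartzMap F ℂ) :
    (𝓕 (tensor (f.toLp 2 volume) (g.toLp 2 volume)) : L2 (WithLp 2 (E × F))) =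
      tensor (𝓕 (f.toLp 2 volume : L2 E)) (𝓕 (g.toLp 2 volume : L2 F)) := by
  set u := tensor (f.toLp 2 volume : L2 E) (g.toLp 2 volume : L2 F) with hu
  have hcoe : u =ᵐ[volume] fun x : WithLp 2 (E × F) ↦ f x.fst * g x.snd := by
    filter_upwards [coeFn_tensor (f.toLp 2 volume : L2 E) (g.toLp 2 volume : L2 F),
      quasiMeasurePreserving_fst.ae (f.coeFn_toLp 2 volume),
      quasiMeasurePreserving_snd.ae (g.coeFn_toLp 2 volume)] with x h1 h2 h3
    rw [hu, h1, h2, h3]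
  have hint : Integrable u volume :=
    (integrable_withLp_mul f.integrable g.integrable).congr hcoe.symm
  have e1 : (𝓕 (f.toLp 2 volume : L2 E) : L2 E) = (𝓕 f).toLp 2 volume :=
    SchwartzMap.toLp_fourier_eq f
  have e2 : (𝓕 (g.toLp 2 volume : L2 F) : L2 F) = (𝓕 g).toLp 2 volume :=
    SchwartzMap.toLp_fourier_eq g
  rw [e1, e2]
  apply Lp.ext
  filter_upwards [fourier_ae_eq_of_integrable u hint,
    coeFn_tensor ((𝓕 f).toLp 2 volume : L2 E) ((𝓕 g).toLp 2 volume : L2 F),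
    quasiMeasurePreserving_fst.ae ((𝓕 f).coeFn_toLp 2 volume),
    quasiMeasurePreserving_snd.ae ((𝓕 g).coeFn_toLp 2 volume)] with ξ h1 h2 h3 h4
  rw [h1, h2, h3, h4, Real.fourier_congr_ae hcoe, SchwartzMap.fourier_coe,
    SchwartzMap.fourier_coe, Real.fourier_eq, Real.fourier_eq, Real.fourier_eq,
    ← integral_withLp_mul]
  refine integral_congr_ae (.of_forall fun x ↦ ?_)
  simp only [WithLp.prod_inner_apply, Circle.smul_def, smul_eq_mul]
  rw [neg_add, AddChar.map_add_eq_mul, Circle.coe_mul]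
  simp only [WithLp.ofLp_fst, WithLp.ofLp_snd]
  ring

/-- The Fourier transform of a tensor product. -/
theorem fourier_tensor (v : L2 E) (φ : L2 F) :
    (𝓕 (tensor v φ) : L2 (WithLp 2 (E × F))) = tensor (𝓕 v) (𝓕 φ) := by
  have hE := SchwartzMap.denseRange_toLpCLM (E := E) (F := ℂ) (p := 2) (μ := volume)
    ENNReal.ofNat_ne_top
  have hF := SchwartzMap.denseRange_toLpCLM (E := F) (F := ℂ) (p := 2) (μ := volume)
    ENNReal.ofNat_ne_top
  have cE := (Lp.fourierTransformₗᵢ E ℂ).continuous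
  have cF := (Lp.fourierTransformₗᵢ F ℂ).continuous
  have cX := (Lp.fourierTransformₗᵢ (WithLp 2 (E × F)) ℂ).continuous
  refine hE.induction_on (p := fun v : L2 E ↦
    (𝓕 (tensor v φ) : L2 (WithLp 2 (E × F))) = tensor (𝓕 v) (𝓕 φ)) v ?_ fun f ↦ ?_
  · exact isClosed_eq (cX.comp (tensorLeft φ).continuous)
      ((tensorLeft (𝓕 φ : L2 F)).continuous.comp cE)
  refine hF.induction_on (p := fun φ : L2 F ↦
    (𝓕 (tensor (f.toLp 2 volume : L2 E) φ) : L2 (WithLp 2 (E × F))) =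
      tensor (𝓕 (f.toLp 2 volume : L2 E)) (𝓕 φ)) φ ?_ fun g ↦ ?_
  · exact isClosed_eq (cX.comp (tensorRight (f.toLp 2 volume : L2 E)).continuous)
      ((tensorRight (𝓕 (f.toLp 2 volume : L2 E) : L2 E)).continuous.comp cF)
  exact fourier_tensor_schwartz f g

end FracDirichlet

/-! ### Parseval's identity along the fibres of a product -/

namespace FracDirichlet

variable {E : Type*} [NormedAddCommGroup E] [InnerProductSpace ℝ E] [FiniteDimensional ℝ E]
  [MeasurableSpace E] [BorelSpace E]
variable {F : Type*} [NormedAddCommGroup F] [InnerProductSpace ℝ F] [FiniteDimensional ℝ F]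
  [MeasurableSpace F] [BorelSpace F]

lemma aestronglyMeasurable_comp_toLp {f : WithLp 2 (E × F) → ℂ}
    (hf : AEStronglyMeasurable f volume) :
    AEStronglyMeasurable (fun p : E × F ↦ f (WithLp.toLp 2 p)) (volume.prod volume) :=
  hf.comp_quasiMeasurePreserving (WithLp.volume_preserving_toLp E F).quasiMeasurePreserving

/-- Almost every slice of a square integrable function is square integrable. -/
lemma ae_memLp_slice {f : WithLp 2 (E × F) → ℂ} (hf : MemLp f 2 volume) :
    ∀ᵐ a : E, MemLp (fun b : F ↦ f (WithLp.toLp 2 (a, b))) 2 volume := by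
  have h1 := (memLp_two_iff_lintegral hf.1).1 hf
  have hm := aestronglyMeasurable_comp_toLp hf.1
  rw [lintegral_withLp (hf.1.enorm.pow_const 2)] at h1
  have hm2 : AEMeasurable (fun a : E ↦ ∫⁻ b : F, ‖f (WithLp.toLp 2 (a, b))‖ₑ ^ 2) volume :=
    (hm.enorm.pow_const 2).lintegral_prod_right'
  filter_upwards [ae_lt_top' hm2 h1.ne, hm.prodMk_left] with a h2 h3
  exact (memLp_two_iff_lintegral h3).2 h2

/-- On almost every slice the partial inner product is an inner product in `L²`. -/
lemma integral_conj_mul_eq_inner (φ : L2 F) {f : F → ℂ} (hf : MemLp f 2 volume) :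
    ∫ b, starRingEnd ℂ (φ b) * f b = ⟪φ, hf.toLp f⟫_ℂ := by
  rw [L2.inner_def]
  refine integral_congr_ae ?_
  filter_upwards [hf.coeFn_toLp] with b h
  rw [h, RCLike.inner_apply, mul_comm]

lemma enorm_toLp_sq {f : F → ℂ} (hf : MemLp f 2 volume) :
    ‖hf.toLp f‖ₑ ^ 2 = ∫⁻ b, ‖f b‖ₑ ^ 2 := by
  rw [enorm_sq_eq_lintegral]
  refine lintegral_congr_ae ?_
  filter_upwards [hf.coeFn_toLp] with b h
  rw [h]

lemma enorm_inner_sq_le (φ ψ : L2 F) : ‖⟪φ, ψ⟫_ℂ‖ₑ ^ 2 ≤ ‖φ‖ₑ ^ 2 * ‖ψ‖ₑ ^ 2 := by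
  rw [← mul_pow, ← ofReal_norm, ← ofReal_norm, ← ofReal_norm,
    ← ENNReal.ofReal_mul (norm_nonneg _)]
  gcongr
  exact norm_inner_le_norm φ ψ

/-- The function `x ↦ ∫ conj (φ y) * f (x, y) dy`. -/
def partialIntegral (φ : L2 F) (f : WithLp 2 (E × F) → ℂ) (a : E) : ℂ :=
  ∫ b, starRingEnd ℂ (φ b) * f (WithLp.toLp 2 (a, b))

lemma enorm_partialIntegral_sq_le (φ : L2 F) {f : WithLp 2 (E × F) → ℂ} (hf : MemLp f 2 volume) :
    ∀ᵐ a : E, ‖partialIntegral φ f a‖ₑ ^ 2 ≤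
      ‖φ‖ₑ ^ 2 * ∫⁻ b : F, ‖f (WithLp.toLp 2 (a, b))‖ₑ ^ 2 := by
  filter_upwards [ae_memLp_slice hf] with a ha
  rw [partialIntegral, integral_conj_mul_eq_inner φ ha, ← enorm_toLp_sq ha]
  exact enorm_inner_sq_le _ _

lemma memLp_partialIntegral (φ : L2 F) {f : WithLp 2 (E × F) → ℂ} (hf : MemLp f 2 volume) :
    MemLp (partialIntegral φ f) 2 volume := by
  have hm : AEStronglyMeasurable (partialIntegral φ f) volume := by
    have h1 : AEStronglyMeasurable (fun p : E × F ↦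
        starRingEnd ℂ (φ p.2) * f (WithLp.toLp 2 p)) (volume.prod volume) :=
      (Complex.continuous_conj.comp_aestronglyMeasurable
        ((Lp.aestronglyMeasurable φ).comp_quasiMeasurePreserving
          Measure.quasiMeasurePreserving_snd)).mul (aestronglyMeasurable_comp_toLp hf.1)
    exact h1.integral_prod_right'
  rw [memLp_two_iff_lintegral hm]
  refine (lintegral_mono_ae (enorm_partialIntegral_sq_le φ hf)).trans_lt ?_
  rw [lintegral_const_mul' _ _ (by simp), ← lintegral_withLp (hf.1.enorm.pow_const 2)]
  exact ENNReal.mul_lt_top (by simp [enorm_lt_top]) ((memLp_two_iff_lintegral hf.1).1 hf)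

/-- The partial inner product of `w` with `φ` in the second variable, the adjoint of
`v ↦ tensor v φ`. -/
def partialInner (φ : L2 F) (w : L2 (WithLp 2 (E × F))) : L2 E :=
  (memLp_partialIntegral φ (Lp.memLp w)).toLp _

lemma coeFn_partialInner (φ : L2 F) (w : L2 (WithLp 2 (E × F))) :
    partialInner φ w =ᵐ[volume] partialIntegral φ w :=
  (memLp_partialIntegral φ (Lp.memLp w)).coeFn_toLp

lemma inner_partialInner (v : L2 E) (φ : L2 F) (w : L2 (WithLp 2 (E × F))) :
    ⟪v, partialInner φ w⟫_ℂ = ⟪tensor v φ, w⟫_ℂ := by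
  rw [L2.inner_def, L2.inner_def, integral_withLp (L2.integrable_inner _ _)]
  refine integral_congr_ae ?_
  filter_upwards [coeFn_partialInner φ w, ae_prod_of_ae (coeFn_tensor v φ)] with a h1 h2
  rw [h1, RCLike.inner_apply, partialIntegral, mul_comm, ← integral_const_mul]
  refine integral_congr_ae ?_
  filter_upwards [h2] with b h3
  rw [h3, RCLike.inner_apply, WithLp.toLp_fst, WithLp.toLp_snd]
  simp only [map_mul]
  ring

/-- The Fourier transform commutes with partial inner products, as it is unitary and commutes with
tensor products. -/
lemma fourier_partialInner (φ : L2 F) (w : L2 (WithLp 2 (E × F))) :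
    (𝓕 (partialInner φ w) : L2 E) = partialInner (𝓕 φ) (𝓕 w) := by
  refine ext_inner_left ℂ fun v' ↦ ?_
  obtain ⟨v, rfl⟩ := (Lp.fourierTransformₗᵢ E ℂ).surjective v'
  change ⟪(𝓕 v : L2 E), 𝓕 (partialInner φ w)⟫_ℂ = ⟪(𝓕 v : L2 E), partialInner (𝓕 φ) (𝓕 w)⟫_ℂ
  rw [Lp.inner_fourier_eq, inner_partialInner, inner_partialInner, ← fourier_tensor,
    Lp.inner_fourier_eq]

/-- An orthonormal family in a separable space is countable, as balls of radius `1/2` about its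
members are disjoint. -/
lemma countable_of_orthonormal {H ι : Type*} [NormedAddCommGroup H] [InnerProductSpace ℂ H]
    [TopologicalSpace.SeparableSpace H] {v : ι → H} (hv : Orthonormal ℂ v) : Countable ι := by
  have h : (univ : Set ι).PairwiseDisjoint fun i ↦ Metric.ball (v i) (1 / 2) := by
    intro i _ j _ hij
    refine Metric.ball_disjoint_ball ?_
    have h1 : ‖v i - v j‖ ^ 2 = 2 := by
      rw [@norm_sub_sq ℂ, hv.2 hij, hv.1 i, hv.1 j]
      norm_num
    rw [dist_eq_norm]
    nlinarith [norm_nonneg (v i - v j)]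
  have h2 := h.countable_of_isOpen (fun _ _ ↦ Metric.isOpen_ball)
    fun i _ ↦ ⟨v i, Metric.mem_ball_self (by norm_num)⟩
  exact countable_univ_iff.1 h2

lemma tsum_enorm_inner_sq {ι : Type*} (b : HilbertBasis ι ℂ (L2 F)) (x : L2 F) :
    ∑' i, ‖⟪b i, x⟫_ℂ‖ₑ ^ 2 = ‖x‖ₑ ^ 2 := by
  have h1 := b.hasSum_inner_mul_inner x x
  have h2 : HasSum (fun i ↦ ‖⟪b i, x⟫_ℂ‖ ^ 2) (‖x‖ ^ 2) := by
    rw [inner_self_eq_norm_sq_to_K] at h1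
    rw [← Complex.hasSum_ofReal]
    simp only [Complex.ofReal_pow]
    have h3 : (fun i ↦ ((‖⟪b i, x⟫_ℂ‖ : ℂ)) ^ 2) = fun i ↦ ⟪x, b i⟫_ℂ * ⟪b i, x⟫_ℂ := by
      funext i
      rw [← inner_conj_symm x, RCLike.conj_mul]
      rfl
    rw [h3]
    exact h1
  have h3 : ∀ i, ‖⟪b i, x⟫_ℂ‖ₑ ^ 2 = ENNReal.ofReal (‖⟪b i, x⟫_ℂ‖ ^ 2) := fun i ↦ by
    rw [ENNReal.ofReal_pow (norm_nonneg _), ofReal_norm]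
  simp only [h3]
  rw [← ENNReal.ofReal_tsum_of_nonneg (fun _ ↦ by positivity) h2.summable, h2.tsum_eq,
    ENNReal.ofReal_pow (norm_nonneg _), ofReal_norm]

lemma tsum_enorm_partialInner_sq {ι : Type*} [Countable ι] (b : HilbertBasis ι ℂ (L2 F))
    (w : L2 (WithLp 2 (E × F))) :
    ∀ᵐ a : E, ∑' i, ‖partialInner (b i) w a‖ₑ ^ 2 =
      ∫⁻ y : F, ‖w (WithLp.toLp 2 (a, y))‖ₑ ^ 2 := by
  filter_upwards [ae_memLp_slice (Lp.memLp w),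
    ae_all_iff.2 fun i ↦ coeFn_partialInner (b i) w] with a h1 h2
  rw [← enorm_toLp_sq h1, ← tsum_enorm_inner_sq b]
  refine tsum_congr fun i ↦ ?_
  rw [h2, partialIntegral, integral_conj_mul_eq_inner (b i) h1]

/-- Parseval's identity for partial inner products, with a weight depending on the first variable
only. -/
lemma tsum_lintegral_partialInner {ι : Type*} [Countable ι] (b : HilbertBasis ι ℂ (L2 F))
    (w : L2 (WithLp 2 (E × F))) {m : E → ENNReal} (hm : Measurable m) :
    ∑' i, ∫⁻ a, m a * ‖partialInner (b i) w a‖ₑ ^ 2 = ∫⁻ x, m x.fst * ‖w x‖ₑ ^ 2 := by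
  have hw := (Lp.aestronglyMeasurable w).enorm.pow_const 2
  have hmi : ∀ i, AEMeasurable (fun a ↦ m a * ‖partialInner (b i) w a‖ₑ ^ 2) volume := fun i ↦
    hm.aemeasurable.mul ((Lp.aestronglyMeasurable (partialInner (b i) w)).enorm.pow_const 2)
  have hmw : AEMeasurable (fun x : WithLp 2 (E × F) ↦ m x.fst * ‖w x‖ₑ ^ 2) volume :=
    (hm.aemeasurable.comp_quasiMeasurePreserving quasiMeasurePreserving_fst).mul hw
  rw [← lintegral_tsum hmi, lintegral_withLp hmw]
  refine lintegral_congr_ae ?_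
  have hs : ∀ᵐ a : E, AEMeasurable (fun y : F ↦ ‖w (WithLp.toLp 2 (a, y))‖ₑ ^ 2) volume := by
    filter_upwards [(aestronglyMeasurable_comp_toLp (Lp.aestronglyMeasurable w)).prodMk_left]
      with a h
    exact h.enorm.pow_const 2
  filter_upwards [tsum_enorm_partialInner_sq b w, hs] with a h1 h2
  rw [ENNReal.tsum_mul_left, h1]
  exact (lintegral_const_mul'' (m a) h2).symm

lemma enorm_fracWeight (s : ℝ) (ξ : E) :
    ‖((fracWeight s ξ : ℝ) : ℂ)‖ₑ = ENNReal.ofReal (fracWeight s ξ) := by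
  rw [← ofReal_norm, Complex.norm_real, Real.norm_of_nonneg (by unfold fracWeight; positivity)]

/-- A lower bound `L` of the form over the cross-section is a lower bound of the form over a
cylinder: decompose along an orthonormal basis in the axial variable, and use
`‖(ξ, τ)‖ ≥ ‖ξ‖` on the Fourier side. -/
theorem lower_bound_cylinder {s : ℝ} (hs : 0 ≤ s) {L : ENNReal} {S : Set E}
    (hL : ∀ v : L2 E, (∀ᵐ x : E, x ∉ S → v x = 0) →
      L * ‖v‖ₑ ^ 2 ≤ ∫⁻ ξ, ‖weighted (fracWeight s) v ξ‖ₑ ^ 2)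
    (u : L2 (WithLp 2 (E × F))) (hu : ∀ᵐ x : WithLp 2 (E × F), x.fst ∉ S → u x = 0) :
    L * ‖u‖ₑ ^ 2 ≤ ∫⁻ ξ, ‖weighted (fracWeight s) u ξ‖ₑ ^ 2 := by
  obtain ⟨B, b, -⟩ := exists_hilbertBasis ℂ (L2 F)
  have : Fact ((2 : ENNReal) ≠ ⊤) := ⟨ENNReal.ofNat_ne_top⟩
  have : Countable B := countable_of_orthonormal b.orthonormal
  set b' : HilbertBasis B ℂ (L2 F) :=
    HilbertBasis.ofRepr ((Lp.fourierTransformₗᵢ F ℂ).symm.trans b.repr) with hb'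
  have hbb : ∀ i, b' i = 𝓕 (b i) := fun i ↦ rfl
  have hsupp : ∀ i, ∀ᵐ x : E, x ∉ S → partialInner (b i) u x = 0 := by
    intro i
    filter_upwards [coeFn_partialInner (b i) u, ae_prod_of_ae hu] with a h1 h2 ha
    rw [h1, partialIntegral]
    refine (integral_congr_ae ?_).trans (integral_zero F ℂ)
    filter_upwards [h2] with y h3
    rw [h3 ha, mul_zero]
  have hm : Measurable fun ξ : E ↦ ENNReal.ofReal (fracWeight s ξ) ^ 2 :=
    ((continuous_fracWeight hs).measurable.ennreal_ofReal).pow_const 2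
  calc L * ‖u‖ₑ ^ 2 = ∑' i, L * ‖partialInner (b i) u‖ₑ ^ 2 := by
        rw [ENNReal.tsum_mul_left]
        congr 1
        have h1 := tsum_lintegral_partialInner b u (m := fun _ ↦ 1) measurable_const
        simp only [one_mul] at h1
        rw [enorm_sq_eq_lintegral, ← h1]
        exact tsum_congr fun i ↦ (enorm_sq_eq_lintegral _).symm
    _ ≤ ∑' i, ∫⁻ ξ, ‖weighted (fracWeight s) (partialInner (b i) u) ξ‖ₑ ^ 2 :=
        ENNReal.tsum_le_tsum fun i ↦ hL _ (hsupp i)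
    _ = ∑' i, ∫⁻ ξ, ENNReal.ofReal (fracWeight s ξ) ^ 2 *
          ‖partialInner (b' i) (𝓕 u : L2 (WithLp 2 (E × F))) ξ‖ₑ ^ 2 := by
        refine tsum_congr fun i ↦ lintegral_congr fun ξ ↦ ?_
        unfold weighted
        rw [fourier_partialInner, hbb, enorm_mul, mul_pow, enorm_fracWeight]
    _ = ∫⁻ x : WithLp 2 (E × F), ENNReal.ofReal (fracWeight s x.fst) ^ 2 *
          ‖(𝓕 u : L2 (WithLp 2 (E × F))) x‖ₑ ^ 2 := tsum_lintegral_partialInner b' _ hm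
    _ ≤ _ := by
        refine lintegral_mono fun x ↦ ?_
        unfold weighted
        rw [enorm_mul, mul_pow, enorm_fracWeight]
        gcongr
        unfold fracWeight
        have := WithLp.norm_fst_le _ x
        gcongr

end FracDirichlet

namespace FracDirichlet

variable {E : Type*} [NormedAddCommGroup E] [InnerProductSpace ℝ E] [FiniteDimensional ℝ E]
  [MeasurableSpace E] [BorelSpace E]

/-! ### Slowly varying modulated profiles on the half-line -/

lemma norm_toLp_sq {f : E → ℂ} (hf : MemLp f 2 volume) :
    ‖hf.toLp f‖ ^ 2 = ∫ x, ‖f x‖ ^ 2 := by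
  have h1 : ((‖hf.toLp f‖ ^ 2 : ℝ) : ℂ) = ((∫ x, ‖f x‖ ^ 2 : ℝ) : ℂ) := by
    rw [← integral_complex_ofReal]
    have h2 := inner_self_eq_norm_sq_to_K (𝕜 := ℂ) (hf.toLp f)
    rw [L2.inner_def] at h2
    push_cast
    refine (h2.symm).trans (integral_congr_ae ?_)
    filter_upwards [hf.coeFn_toLp] with x h
    rw [h, inner_self_eq_norm_sq_to_K]
    simp
  exact_mod_cast h1

/-- The profile `y ↦ exp (2πiηy) f (y / R)`. -/
def profile (f : SchwartzMap ℝ ℂ) (η R : ℝ) (y : ℝ) : ℂ :=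
  (Real.fourierChar (η * y) : ℂ) * f (y / R)

lemma continuous_profile (f : SchwartzMap ℝ ℂ) (η R : ℝ) : Continuous (profile f η R) := by
  unfold profile
  have := f.continuous
  fun_prop

lemma norm_profile (f : SchwartzMap ℝ ℂ) (η R y : ℝ) : ‖profile f η R y‖ = ‖f (y / R)‖ := by
  unfold profile
  rw [norm_mul, Circle.norm_coe, one_mul]

lemma integrable_profile (f : SchwartzMap ℝ ℂ) (η : ℝ) {R : ℝ} (hR : 0 < R) :
    Integrable (profile f η R) volume := by
  refine ((f.integrable (μ := volume)).comp_div hR.ne').mono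
    (continuous_profile f η R).aestronglyMeasurable (.of_forall fun y ↦ ?_)
  rw [norm_profile]

lemma memLp_profile (f : SchwartzMap ℝ ℂ) (η : ℝ) {R : ℝ} (hR : 0 < R) :
    MemLp (profile f η R) 2 volume := by
  rw [memLp_two_iff_integrable_sq_norm (continuous_profile f η R).aestronglyMeasurable]
  simp only [norm_profile]
  exact ((memLp_two_iff_integrable_sq_norm f.continuous.aestronglyMeasurable).1
    (f.memLp 2 volume)).comp_div (g := fun y ↦ ‖f y‖ ^ 2) hR.ne'

lemma fourier_profile (f : SchwartzMap ℝ ℂ) (η : ℝ) {R : ℝ} (hR : 0 < R) (τ : ℝ) :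
    𝓕 (profile f η R) τ = R * (𝓕 f) (R * (τ - η)) := by
  rw [SchwartzMap.fourier_coe, Real.fourier_real_eq, Real.fourier_real_eq]
  have h1 : ∀ y, Real.fourierChar (-(y * τ)) • profile f η R y =
      (fun z ↦ Real.fourierChar (-(z * (R * (τ - η)))) • f z) (y / R) := by
    intro y
    simp only [profile, Circle.smul_def, smul_eq_mul]
    rw [← mul_assoc, ← Circle.coe_mul, ← AddChar.map_add_eq_mul]
    congr 3
    field_simp
    ring
  rw [integral_congr_ae (.of_forall h1)]
  refine (Measure.integral_comp_div (fun z ↦ Real.fourierChar (-(z * (R * (τ - η)))) • f z)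
    R).trans ?_
  rw [abs_of_pos hR, Complex.real_smul]

lemma fracWeight_mul {s R : ℝ} (hR : 0 < R) (t : ℝ) :
    fracWeight s (R * t) = R ^ s * fracWeight s t := by
  unfold fracWeight
  rw [← Real.mul_rpow hR.le (by positivity), norm_mul, Real.norm_of_nonneg hR.le]
  congr 1
  ring

/-- There are normalized functions on the half-line whose Fourier transforms concentrate at a given
frequency `η`. -/
theorem exists_profile {s : ℝ} (hs : 0 < s) (hs1 : s ≤ 1) (η : ℝ) {ε : ℝ} (hε : 0 < ε) :
    ∃ ψ W : L2 ℝ, ‖ψ‖ = 1 ∧ ‖W‖ ≤ ε ∧ (∀ᵐ y : ℝ, ¬ 0 < y → ψ y = 0) ∧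
      W =ᵐ[volume] fun τ ↦ (fracWeight s (τ - η) : ℂ) * (𝓕 ψ : L2 ℝ) τ := by
  obtain ⟨f, hf0, hf⟩ := exists_schwartz_tsupport_subset (isOpen_Ioi (a := (0 : ℝ))) ⟨1, by simp⟩
  set A : ℝ := ‖(f.toLp 2 volume : L2 ℝ)‖ ^ 2 with hA
  have hA0 : 0 < A := by
    have := norm_pos_iff.2 (toLp_schwartz_ne_zero hf0)
    positivity
  have hAint : ∫ y, ‖f y‖ ^ 2 = A := (norm_toLp_sq (f.memLp 2 volume)).symm
  have hwf := memLp_fracWeight_mul_schwartz hs.le hs1 (𝓕 f)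
  obtain ⟨D, hD⟩ : ∃ D : ℝ → ℝ, D = fun t ↦ ‖(fracWeight s t : ℂ) * (𝓕 f) t‖ ^ 2 := ⟨_, rfl⟩
  have hDi : Integrable D volume := by
    rw [hD]
    exact (memLp_two_iff_integrable_sq_norm hwf.1).1 hwf
  set C : ℝ := ∫ t, D t with hC
  have hC0 : 0 ≤ C := integral_nonneg fun t ↦ by rw [hD]; positivity
  -- the scale for which `R ^ (2 s) = C / (A ε²) + 1`
  set R : ℝ := (C / (A * ε ^ 2) + 1) ^ (2 * s)⁻¹ with hRdef
  have hR : 0 < R := by positivity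
  have hR2s : (R ^ s) ^ 2 = C / (A * ε ^ 2) + 1 := by
    rw [← Real.rpow_natCast, ← Real.rpow_mul hR.le, hRdef, Nat.cast_ofNat, mul_comm s 2,
      Real.rpow_inv_rpow (by positivity) (by positivity)]
  have hp := memLp_profile f η hR
  set u : L2 ℝ := hp.toLp _ with hu
  have hun : ‖u‖ ^ 2 = R * A := by
    rw [hu, norm_toLp_sq]
    simp only [norm_profile]
    rw [Measure.integral_comp_div (fun y ↦ ‖f y‖ ^ 2), hAint, abs_of_pos hR, smul_eq_mul]
  have hu0 : 0 < ‖u‖ := by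
    have : 0 < ‖u‖ ^ 2 := by rw [hun]; positivity
    by_contra! h0
    rw [le_antisymm h0 (norm_nonneg _)] at this
    norm_num at this
  have huF : (𝓕 u : L2 ℝ) =ᵐ[volume] fun τ ↦ R * (𝓕 f) (R * (τ - η)) := by
    have hint : Integrable u volume := (integrable_profile f η hR).congr hp.coeFn_toLp.symm
    filter_upwards [fourier_ae_eq_of_integrable u hint] with τ h1
    rw [h1, Real.fourier_congr_ae hp.coeFn_toLp, fourier_profile f η hR]
  set G : ℝ → ℂ := fun τ ↦ (fracWeight s (τ - η) : ℂ) * (R * (𝓕 f) (R * (τ - η))) with hG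
  have hGeq : ∀ τ, ‖G τ‖ ^ 2 = (R / R ^ s) ^ 2 * D (R * (τ - η)) := by
    intro τ
    simp only [hG, hD, norm_mul, Complex.norm_real, fracWeight_mul hR, Real.norm_of_nonneg hR.le,
      Real.norm_of_nonneg (Real.rpow_nonneg hR.le s)]
    field_simp
  have hGc : Continuous G := by
    have h1 := (𝓕 f).continuous
    have h2 : Continuous fun τ ↦ fracWeight s (τ - η) :=
      (continuous_fracWeight hs.le).comp (continuous_id.sub continuous_const)
    exact (Complex.continuous_ofReal.comp h2).mul
      (continuous_const.mul (h1.comp (continuous_const.mul (continuous_id.sub continuous_const))))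
  have hGL : MemLp G 2 volume := by
    rw [memLp_two_iff_integrable_sq_norm hGc.aestronglyMeasurable]
    simp only [hGeq]
    exact ((hDi.comp_mul_left' hR.ne').comp_sub_right η).const_mul _
  have hGn : ‖hGL.toLp G‖ ^ 2 = (R / R ^ s) ^ 2 * (R⁻¹ * C) := by
    rw [norm_toLp_sq]
    simp only [hGeq]
    rw [integral_const_mul, integral_sub_right_eq_self (fun t ↦ D (R * t)) η,
      Measure.integral_comp_mul_left, abs_of_pos (inv_pos.2 hR), smul_eq_mul]
  set c : ℂ := ((‖u‖⁻¹ : ℝ) : ℂ) with hc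
  have hcn : ‖c‖ = ‖u‖⁻¹ := by
    rw [hc, Complex.norm_real, Real.norm_of_nonneg (by positivity)]
  refine ⟨c • u, c • hGL.toLp G, ?_, ?_, ?_, ?_⟩
  · rw [norm_smul, hcn, inv_mul_cancel₀ hu0.ne']
  · rw [norm_smul, hcn, inv_mul_le_iff₀ hu0]
    refine (sq_le_sq₀ (norm_nonneg _) (by positivity)).1 ?_
    rw [hGn, mul_pow, hun]
    have h1 : (R / R ^ s) ^ 2 * (R⁻¹ * C) = R * (C / (R ^ s) ^ 2) := by
      have : R ^ s ≠ 0 := (Real.rpow_pos_of_pos hR s).ne'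
      field_simp
    rw [h1, mul_assoc]
    gcongr
    rw [hR2s, div_le_iff₀ (by positivity)]
    have h2 : A * ε ^ 2 * (C / (A * ε ^ 2) + 1) = C + A * ε ^ 2 := by
      field_simp
    rw [h2]
    have : 0 < A * ε ^ 2 := by positivity
    linarith
  · filter_upwards [Lp.coeFn_smul c u, hp.coeFn_toLp] with y h1 h2 hy
    rw [h1, Pi.smul_apply, hu, h2]
    have h3 : ¬ 0 < y / R := by rwa [div_pos_iff_of_pos_right hR]
    rw [profile, hf _ h3, mul_zero, smul_zero]
  · have h0 : (𝓕 (c • u) : L2 ℝ) = c • 𝓕 u := FourierTransform.fourier_smul c u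
    rw [h0]
    filter_upwards [Lp.coeFn_smul c (𝓕 u : L2 ℝ), Lp.coeFn_smul c (hGL.toLp G), huF,
      hGL.coeFn_toLp] with τ h1 h2 h3 h4
    rw [h1, h2, Pi.smul_apply, Pi.smul_apply, h3, h4, hG]
    simp only [smul_eq_mul]
    ring

/-! ### The closure of the semi-tube -/

variable {d : ℕ} {ω : Set (EuclideanSpace ℝ (Fin d))}

lemma fst_mem_closure_of_mem_closure_semiTube
    {x : WithLp 2 (EuclideanSpace ℝ (Fin d) × ℝ)} (hx : x ∈ closure (semiTube ω)) :
    x.fst ∈ closure ω :=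
  map_mem_closure (WithLp.continuous_fst 2 _ _) hx fun _ hy ↦ hy.1

lemma mem_closure_semiTube {x : WithLp 2 (EuclideanSpace ℝ (Fin d) × ℝ)}
    (hx : x.fst ∈ closure ω) (hx' : 0 < x.snd) : x ∈ closure (semiTube ω) :=
  map_mem_closure (f := fun a ↦ (WithLp.toLp 2 (a, x.snd) :
    WithLp 2 (EuclideanSpace ℝ (Fin d) × ℝ)))
    ((WithLp.prod_continuous_toLp 2 _ _).comp (continuous_id.prodMk continuous_const)) hx
    fun _ ha ↦ ⟨ha, hx'⟩

end FracDirichlet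

/-! ### Approximate eigenfunctions over a cylinder -/

namespace FracDirichlet

variable {E : Type*} [NormedAddCommGroup E] [InnerProductSpace ℝ E] [FiniteDimensional ℝ E]
  [MeasurableSpace E] [BorelSpace E]

lemma fracWeight_nonneg (s : ℝ) (ξ : E) : 0 ≤ fracWeight s ξ := by
  unfold fracWeight; positivity

lemma memLp_mul_of_norm_le {β γ : E → ℂ} (hβ : Continuous β) (h : ∀ x, ‖β x‖ ≤ ‖γ x‖)
    {P Q : L2 E} (hQ : Q =ᵐ[volume] fun x ↦ γ x * P x) :
    MemLp (fun x ↦ β x * P x) 2 volume := by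
  refine (Lp.memLp Q).mono (hβ.aestronglyMeasurable.mul (Lp.aestronglyMeasurable P)) ?_
  filter_upwards [hQ] with x hx
  rw [hx, norm_mul, norm_mul]
  exact mul_le_mul_of_nonneg_right (h x) (norm_nonneg _)

lemma norm_toLp_mul_le {β γ : E → ℂ} (h : ∀ x, ‖β x‖ ≤ ‖γ x‖)
    {P Q : L2 E} (hQ : Q =ᵐ[volume] fun x ↦ γ x * P x)
    (hm : MemLp (fun x ↦ β x * P x) 2 volume) : ‖hm.toLp _‖ ≤ ‖Q‖ := by
  refine Lp.norm_le_norm_of_ae_le ?_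
  filter_upwards [hQ, hm.coeFn_toLp] with x hx h1
  rw [hx, h1, norm_mul, norm_mul]
  exact mul_le_mul_of_nonneg_right (h x) (norm_nonneg _)

/-- The difference between the weight over the cylinder and the weight with frozen frequency. -/
def weightDiff (s η : ℝ) (x : WithLp 2 (E × ℝ)) : ℂ :=
  ((fracWeight s x - weight s η x.fst : ℝ) : ℂ)

lemma norm_weightDiff_le {s : ℝ} (hs : 0 ≤ s) (hs1 : s ≤ 1) (η : ℝ) (x : WithLp 2 (E × ℝ)) :
    ‖weightDiff s η x‖ ≤ ‖((fracWeight s (x.snd - η) : ℝ) : ℂ)‖ := by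
  rw [weightDiff, Complex.norm_real, Complex.norm_real, Real.norm_eq_abs,
    Real.norm_of_nonneg (fracWeight_nonneg s (x.snd - η))]
  exact abs_weight_sub_le hs hs1 x.snd η x.fst

lemma continuous_weight_fst {s : ℝ} (hs : 0 ≤ s) (η : ℝ) :
    Continuous fun x : WithLp 2 (E × ℝ) ↦ weight s η x.fst :=
  (continuous_weight_left hs η).comp (WithLp.continuous_fst 2 E ℝ)

lemma continuous_weightDiff {s : ℝ} (hs : 0 ≤ s) (η : ℝ) :
    Continuous (weightDiff s η : WithLp 2 (E × ℝ) → ℂ) :=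
  Complex.continuous_ofReal.comp ((continuous_fracWeight hs).sub (continuous_weight_fst hs η))

/-- On the form domain over a cylinder, the weight with frozen frequency gives square integrable
functions, as it exceeds the full weight by at most a constant. -/
lemma memLp_weight_fst_mul {s : ℝ} (hs : 0 ≤ s) (hs1 : s ≤ 1) (η : ℝ)
    {w : L2 (WithLp 2 (E × ℝ))} (hw : MemLp (weighted (fracWeight s) w) 2 volume) :
    MemLp (fun x : WithLp 2 (E × ℝ) ↦
      (weight s η x.fst : ℂ) * (𝓕 w : L2 (WithLp 2 (E × ℝ))) x) 2 volume := by
  have h1 := hw.add ((Lp.memLp (𝓕 w : L2 (WithLp 2 (E × ℝ)))).const_mul ((fracWeight s η : ℝ) : ℂ))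
  refine h1.mono ((Complex.continuous_ofReal.comp
    (continuous_weight_fst hs η)).aestronglyMeasurable.mul (Lp.aestronglyMeasurable _))
    (.of_forall fun x ↦ ?_)
  have h2 := weight_le_add hs hs1 η 0 x.fst
  rw [sub_zero, weight_zero] at h2
  have h3 : fracWeight s x.fst ≤ fracWeight s x := fracWeight_le_weight hs x.snd x.fst
  have h4 := weight_nonneg s η x.fst
  have h5 : (weighted (fracWeight s) w + fun x ↦ ((fracWeight s η : ℝ) : ℂ) *
      (𝓕 w : L2 (WithLp 2 (E × ℝ))) x) x =
      ((fracWeight s x + fracWeight s η : ℝ) : ℂ) * (𝓕 w : L2 (WithLp 2 (E × ℝ))) x := by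
    simp only [Pi.add_apply, weighted]
    push_cast
    ring
  rw [h5, norm_mul, norm_mul, Complex.norm_real, Complex.norm_real, Real.norm_of_nonneg h4,
    Real.norm_of_nonneg (by linarith)]
  exact mul_le_mul_of_nonneg_right (by linarith) (norm_nonneg _)

lemma weighted_partialInner {s η : ℝ} (ψ : L2 ℝ) {w : L2 (WithLp 2 (E × ℝ))}
    (hZ : MemLp (fun x : WithLp 2 (E × ℝ) ↦
      (weight s η x.fst : ℂ) * (𝓕 w : L2 (WithLp 2 (E × ℝ))) x) 2 volume) :
    weighted (weight s η) (partialInner ψ w) =ᵐ[volume] partialInner (𝓕 ψ) (hZ.toLp _) := by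
  unfold weighted
  rw [fourier_partialInner]
  filter_upwards [coeFn_partialInner (𝓕 ψ) (𝓕 w), coeFn_partialInner (𝓕 ψ) (hZ.toLp _),
    ae_prod_of_ae hZ.coeFn_toLp] with a h1 h2 h3
  rw [h1, h2, partialIntegral, partialIntegral, ← integral_const_mul]
  refine integral_congr_ae ?_
  filter_upwards [h3] with y h4
  rw [h4]
  simp only [WithLp.toLp_fst]
  ring

lemma partialInner_ae_eq_zero {Ω : Set E} (ψ : L2 ℝ) {w : L2 (WithLp 2 (E × ℝ))}
    (hw : ∀ᵐ x : WithLp 2 (E × ℝ), x.fst ∉ Ω → w x = 0) :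
    ∀ᵐ x : E, x ∉ Ω → partialInner ψ w x = 0 := by
  filter_upwards [coeFn_partialInner ψ w, ae_prod_of_ae hw] with a h1 h2 ha
  rw [h1, partialIntegral]
  refine (integral_congr_ae ?_).trans (integral_zero ℝ ℂ)
  filter_upwards [h2] with y h3
  rw [h3 ha, mul_zero]

/-- The ground state equation over the cross-section, tested with partial inner products of a
function `w` over the cylinder. -/
lemma IsGroundState.inner_tensor {s η L : ℝ} {Ω : Set E} {g : formGraph (weight s η) Ω}
    (hg : IsGroundState g L) (ψ : L2 ℝ) {w : L2 (WithLp 2 (E × ℝ))}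
    (hw : ∀ᵐ x : WithLp 2 (E × ℝ), x.fst ∉ closure Ω → w x = 0)
    (hZ : MemLp (fun x : WithLp 2 (E × ℝ) ↦
      (weight s η x.fst : ℂ) * (𝓕 w : L2 (WithLp 2 (E × ℝ))) x) 2 volume) :
    ⟪hZ.toLp _, tensor (formSnd g) (𝓕 ψ)⟫_ℂ =
      L * ⟪w, tensor (formFst (weight s η) Ω g) ψ⟫_ℂ := by
  have hp := weighted_partialInner ψ hZ
  have hpm : MemLp (weighted (weight s η) (partialInner ψ w)) 2 volume :=
    (memLp_congr_ae hp).2 (Lp.memLp _)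
  have heul := hg.euler (formMk (partialInner ψ w) hpm (partialInner_ae_eq_zero ψ hw))
  have h1 : formSnd (formMk (partialInner ψ w) hpm (partialInner_ae_eq_zero ψ hw)) =
      partialInner (𝓕 ψ) (hZ.toLp _) := by
    apply Lp.ext
    exact hpm.coeFn_toLp.trans hp
  have h2 : formFst (weight s η) Ω (formMk (partialInner ψ w) hpm (partialInner_ae_eq_zero ψ hw)) =
      partialInner ψ w := rfl
  rwa [h1, h2, ← inner_conj_symm, inner_partialInner, inner_conj_symm,
    ← inner_conj_symm (partialInner ψ w), inner_partialInner, inner_conj_symm] at heul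

lemma weighted_tensor {s η : ℝ} {Ω : Set E} (g : formGraph (weight s η) Ω) (χ : L2 ℝ) :
    tensor (formSnd g) χ =ᵐ[volume] fun x : WithLp 2 (E × ℝ) ↦
      (weight s η x.fst : ℂ) * tensor (𝓕 (formFst (weight s η) Ω g)) χ x := by
  filter_upwards [coeFn_tensor (formSnd g) χ, coeFn_tensor (𝓕 (formFst (weight s η) Ω g)) χ,
    quasiMeasurePreserving_fst.ae g.2.1] with x h1 h2 h3
  rw [h1, h2, h3, weighted, mul_assoc]
  rfl

lemma tensor_weighted {s η : ℝ} (v : L2 E) {χ W : L2 ℝ}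
    (hW : W =ᵐ[volume] fun τ ↦ (fracWeight s (τ - η) : ℂ) * χ τ) :
    tensor v W =ᵐ[volume] fun x : WithLp 2 (E × ℝ) ↦
      (fracWeight s (x.snd - η) : ℂ) * tensor v χ x := by
  filter_upwards [coeFn_tensor v W, coeFn_tensor v χ, quasiMeasurePreserving_snd.ae hW]
    with x h1 h2 h3
  rw [h1, h2, h3]
  ring

/-- The product of a ground state at frequency `η` with a function of the axial variable that
concentrates at the frequency `η` satisfies the eigenvalue equation over the semi-tube
approximately. -/
theorem exists_approx_eigenfunction {s : ℝ} (hs : 0 < s) (hs1 : s ≤ 1) {η L : ℝ} {Ω : Set E}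
    {C : Set (WithLp 2 (E × ℝ))} (hC : ∀ x ∈ closure C, x.fst ∈ closure Ω)
    (hC' : ∀ x : WithLp 2 (E × ℝ), x.fst ∈ closure Ω → 0 < x.snd → x ∈ closure C)
    {g : formGraph (weight s η) Ω} (hg : IsGroundState g L) {ε : ℝ} (hε : 0 < ε) :
    ∃ h : formGraph (fracWeight s) C, ‖formFst (fracWeight s) C h‖ = 1 ∧
      ∀ v, ‖⟪v, h⟫_ℂ - (L + 1) * ⟪formFst (fracWeight s) C v, formFst (fracWeight s) C h⟫_ℂ‖ ≤
        ε * ‖v‖ := by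
  obtain ⟨ψ, W, hψ, hW, hψs, hWe⟩ :=
    exists_profile hs hs1 η (ε := ε / (1 + √L)) (by positivity)
  set φ : L2 E := formFst (weight s η) Ω g with hφ
  set u := tensor φ ψ with hu
  have hFu : (𝓕 u : L2 (WithLp 2 (E × ℝ))) = tensor (𝓕 φ) (𝓕 ψ) := fourier_tensor φ ψ
  set T := tensor (formSnd g) (𝓕 ψ) with hT
  have eT : T =ᵐ[volume] fun x : WithLp 2 (E × ℝ) ↦
      (weight s η x.fst : ℂ) * tensor (𝓕 φ) (𝓕 ψ) x := weighted_tensor g (𝓕 ψ)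
  have eW := tensor_weighted (𝓕 φ) hWe
  have eTW := tensor_weighted (formSnd g) hWe
  have hdiff := norm_weightDiff_le (E := E) hs.le hs1 η
  -- `(b - b_η) 𝓕 u` and `(b - b_η) b_η 𝓕 u` are small
  have hY₁ := memLp_mul_of_norm_le (continuous_weightDiff hs.le η) hdiff eW
  have hY₂ := memLp_mul_of_norm_le (continuous_weightDiff hs.le η) hdiff eTW
  have hn₁ : ‖hY₁.toLp _‖ ≤ ε / (1 + √L) := by
    refine (norm_toLp_mul_le hdiff eW hY₁).trans ?_
    rw [norm_tensor, Lp.norm_fourier_eq, hφ, hg.norm_eq, one_mul]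
    exact hW
  have hn₂ : ‖hY₂.toLp _‖ ≤ √L * (ε / (1 + √L)) := by
    refine (norm_toLp_mul_le hdiff eTW hY₂).trans ?_
    rw [norm_tensor, hg.norm_snd]
    gcongr
  have hmem : MemLp (weighted (fracWeight s) u) 2 volume := by
    refine (memLp_congr_ae ?_).1 ((Lp.memLp T).add hY₁)
    filter_upwards [eT] with x h1
    rw [Pi.add_apply, h1, weighted, hFu, weightDiff]
    push_cast
    ring
  have hsupp : ∀ᵐ x : WithLp 2 (E × ℝ), x ∉ closure C → u x = 0 := by
    filter_upwards [coeFn_tensor φ ψ, quasiMeasurePreserving_fst.ae g.2.2,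
      quasiMeasurePreserving_snd.ae hψs] with x h1 h2 h3 hx
    rw [hu, h1]
    by_cases hfst : x.fst ∈ closure Ω
    · rw [h3 fun hsnd ↦ hx (hC' x hfst hsnd), mul_zero]
    · rw [hφ, formFst_apply, h2 hfst, zero_mul]
  refine ⟨formMk u hmem hsupp, ?_, fun v ↦ ?_⟩
  · change ‖u‖ = 1
    rw [hu, norm_tensor, hφ, hg.norm_eq, hψ, one_mul]
  set w := formFst (fracWeight s) C v with hw
  set Fw : L2 (WithLp 2 (E × ℝ)) := 𝓕 w with hFw
  have hVe : formSnd v =ᵐ[volume] fun x ↦ (fracWeight s x : ℂ) * Fw x := v.2.1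
  have hZ := memLp_weight_fst_mul hs.le hs1 η (memLp_weighted_of_mem v)
  have hws : ∀ᵐ x : WithLp 2 (E × ℝ), x.fst ∉ closure Ω → w x = 0 := by
    filter_upwards [v.2.2] with x h1 hx
    exact h1 fun hxC ↦ hx (hC x hxC)
  have heul := hg.inner_tensor ψ hws hZ
  have hres : ⟪v, formMk u hmem hsupp⟫_ℂ - (L + 1) * ⟪w, u⟫_ℂ =
      ⟪formSnd v, hY₁.toLp _⟫_ℂ + ⟪Fw, hY₂.toLp _⟫_ℂ := by
    have h3 : ⟪v, (formMk u hmem hsupp : formGraph (fracWeight s) C)⟫_ℂ =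
        ⟪w, u⟫_ℂ + ⟪formSnd v, hmem.toLp _⟫_ℂ := rfl
    have h4 : ⟪formSnd v, hmem.toLp _⟫_ℂ = ⟪hZ.toLp _, T⟫_ℂ + (⟪formSnd v, hY₁.toLp _⟫_ℂ +
        ⟪Fw, hY₂.toLp _⟫_ℂ) := by
      rw [L2.inner_def, L2.inner_def, L2.inner_def, L2.inner_def]
      rw [← integral_add (L2.integrable_inner _ _) (L2.integrable_inner _ _),
        ← integral_add (L2.integrable_inner _ _)
          ((L2.integrable_inner _ _).add (L2.integrable_inner _ _))]
      refine integral_congr_ae ?_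
      filter_upwards [hVe, hmem.coeFn_toLp, hZ.coeFn_toLp, hY₁.coeFn_toLp, hY₂.coeFn_toLp, eT]
        with x e1 e2 e3 e4 e5 e6
      rw [e1, e2, e3, e4, e5, e6, weighted, hFu, weightDiff]
      simp only [RCLike.inner_apply, map_mul, Complex.conj_ofReal]
      push_cast
      ring
    rw [h3, h4, heul]
    ring
  change ‖⟪v, formMk u hmem hsupp⟫_ℂ - (L + 1) * ⟪w, u⟫_ℂ‖ ≤ ε * ‖v‖
  rw [hres]
  have b1 : ‖formSnd v‖ ≤ ‖v‖ := WithLp.norm_snd_le _ _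
  have b2 : ‖Fw‖ ≤ ‖v‖ := by
    rw [hFw, Lp.norm_fourier_eq]
    exact WithLp.norm_fst_le _ _
  calc _ ≤ ‖formSnd v‖ * ‖hY₁.toLp _‖ + ‖Fw‖ * ‖hY₂.toLp _‖ :=
        (norm_add_le _ _).trans (add_le_add (norm_inner_le_norm _ _) (norm_inner_le_norm _ _))
    _ ≤ ‖v‖ * (ε / (1 + √L)) + ‖v‖ * (√L * (ε / (1 + √L))) := by gcongr
    _ = ε * ‖v‖ := by
        have : 1 + √L ≠ 0 := by positivity
        field_simp

end FracDirichlet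

/-! ### The spectrum -/

namespace FracDirichlet

section

variable {E : Type*} [NormedAddCommGroup E] [InnerProductSpace ℝ E] [FiniteDimensional ℝ E]
  [MeasurableSpace E] [BorelSpace E]

lemma inner_formSnd {s : ℝ} {Ω : Set E} (v g : formGraph (fracWeight s) Ω) :
    ⟪formSnd v, formSnd g⟫_ℂ =
      fracForm s (formFst (fracWeight s) Ω v) (formFst (fracWeight s) Ω g) :=
  add_left_cancel ((inner_formGraph' v g).symm.trans (inner_formGraph v g))

lemma mem_realEigenvalues_iff {s l : ℝ} {Ω : Set E} :
    l ∈ (operator s Ω).realEigenvalues ↔ ∃ x : stateSpace s Ω, x ≠ 0 ∧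
      (x, (l : ℂ) • x) ∈ operatorGraph s Ω := by
  rw [← operator_graph]
  constructor
  · rintro ⟨x, hx, h⟩
    exact ⟨x, hx, h ▸ (operator s Ω).mem_graph x⟩
  · rintro ⟨x, hx, h⟩
    obtain ⟨y, hy1, hy2⟩ := (operator s Ω).mem_graph_iff.1 h
    simp only at hy1 hy2
    exact ⟨y, by rwa [hy1], by rw [hy2, hy1]⟩

/-- The energy of a ground state is the smallest eigenvalue of the fractional Laplacian. -/
theorem IsGroundState.isLeast_realEigenvalues {s L : ℝ} {Ω : Set E}
    {g : formGraph (fracWeight s) Ω} (hg : IsGroundState g L) :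
    IsLeast (operator s Ω).realEigenvalues L := by
  constructor
  · refine mem_realEigenvalues_iff.2 ⟨formEmbedding s Ω g, fun h ↦ ?_, ?_, fun v hv ↦ ?_⟩
    · have h1 := hg.norm_eq
      have h2 : formFst (fracWeight s) Ω g = 0 := congrArg Subtype.val h
      rw [h2, norm_zero] at h1
      exact zero_ne_one h1
    · exact formFst_mem_formDomain s Ω g
    · have h1 := hg.euler (formMk v hv.1 hv.2)
      rw [inner_formSnd] at h1
      rw [Submodule.coe_smul, inner_smul_right]
      exact h1
  · intro l hl
    obtain ⟨x, hx, hxd, h⟩ := mem_realEigenvalues_iff.1 hl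
    set y : formGraph (fracWeight s) Ω := formMk (x : L2 E) hxd.1 hxd.2 with hy
    have hyx : formFst (fracWeight s) Ω y = x := rfl
    have h1 : ⟪formSnd y, formSnd y⟫_ℂ = (l : ℂ) * ⟪(x : L2 E), (x : L2 E)⟫_ℂ := by
      have h2 := h x hxd
      rw [Submodule.coe_smul, inner_smul_right] at h2
      rw [inner_formSnd, hyx]
      exact h2
    rw [inner_self_eq_norm_sq_to_K, inner_self_eq_norm_sq_to_K] at h1
    have h2 : ‖formSnd y‖ ^ 2 = l * ‖(x : L2 E)‖ ^ 2 := by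
      have h3 : ((‖formSnd y‖ ^ 2 : ℝ) : ℂ) = ((l * ‖(x : L2 E)‖ ^ 2 : ℝ) : ℂ) := by
        push_cast
        exact h1
      exact_mod_cast h3
    have h3 := hg.lower y
    rw [hyx, h2] at h3
    have h4 : 0 < ‖(x : L2 E)‖ := norm_pos_iff.2 fun h0 ↦ hx (Subtype.ext h0)
    exact le_of_mul_le_mul_right h3 (by positivity)

/-- The lower bound by the ground state energy, for all functions in `L²` that vanish outside
`closure Ω`; the form is infinite outside the form domain. -/
lemma IsGroundState.ofReal_mul_le {s : ℝ} (hs : 0 ≤ s) {L : ℝ} {Ω : Set E}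
    {g : formGraph (fracWeight s) Ω} (hg : IsGroundState g L) (v : L2 E)
    (hv : ∀ᵐ x : E, x ∉ closure Ω → v x = 0) :
    ENNReal.ofReal L * ‖v‖ₑ ^ 2 ≤ ∫⁻ ξ, ‖weighted (fracWeight s) v ξ‖ₑ ^ 2 := by
  by_cases h : ∫⁻ ξ, ‖weighted (fracWeight s) v ξ‖ₑ ^ 2 < ⊤
  · have hm := (memLp_two_iff_lintegral
      (aestronglyMeasurable_weighted (continuous_fracWeight hs) v)).2 h
    have h1 := hg.lower (formMk v hm hv)
    have h2 := enorm_snd_formGraph_sq (formMk v hm hv : formGraph (fracWeight s) Ω)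
    have h3 : formFst (fracWeight s) Ω (formMk v hm hv) = v := rfl
    rw [h3] at h1 h2
    rw [← h2, ← ofReal_norm, ← ofReal_norm, ← ENNReal.ofReal_pow (norm_nonneg _),
      ← ENNReal.ofReal_pow (norm_nonneg _), ← ENNReal.ofReal_mul hg.nonneg]
    exact ENNReal.ofReal_le_ofReal h1
  · rw [not_lt_top_iff.1 h]
    exact le_top

/-- The ground state energy of the cross-section bounds the form over a cylinder from below. -/
lemma IsGroundState.lower_bound_of_cylinder {s : ℝ} (hs : 0 ≤ s) {L : ℝ} {Ω : Set E}
    {C : Set (WithLp 2 (E × ℝ))} (hC : ∀ x ∈ closure C, x.fst ∈ closure Ω)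
    {g : formGraph (fracWeight s) Ω} (hg : IsGroundState g L) (v : formGraph (fracWeight s) C) :
    L * ‖formFst (fracWeight s) C v‖ ^ 2 ≤ ‖formSnd v‖ ^ 2 := by
  have h1 : ∀ᵐ x : WithLp 2 (E × ℝ), x.fst ∉ closure Ω → formFst (fracWeight s) C v x = 0 := by
    filter_upwards [v.2.2] with x h1 hx
    exact h1 fun hxC ↦ hx (hC x hxC)
  have h2 := lower_bound_cylinder hs (hg.ofReal_mul_le hs) _ h1
  rw [← enorm_snd_formGraph_sq v, ← ofReal_norm, ← ofReal_norm,
    ← ENNReal.ofReal_pow (norm_nonneg _), ← ENNReal.ofReal_pow (norm_nonneg _),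
    ← ENNReal.ofReal_mul hg.nonneg] at h2
  exact (ENNReal.ofReal_le_ofReal_iff (by positivity)).1 h2

end

end FracDirichlet

end

theorem mainTheorem5 (d : ℕ) (hd : 1 ≤ d) (s : ℝ) (hs0 : 0 < s) (hs1 : s < 1)
    (ω : Set (EuclideanSpace ℝ (Fin d))) (hω_open : IsOpen ω) (hω_conn : IsConnected ω)
    (hω_bdd : Bornology.IsBounded ω) :
    ∃ Λ : ℝ, IsLeast (FracDirichlet.operator s ω).realEigenvalues Λ ∧
      (FracDirichlet.operator s (FracDirichlet.semiTube ω)).spectrumC =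
        (fun t : ℝ ↦ (t : ℂ)) '' Set.Ici Λ := by
  open FracDirichlet in
  have hcl : ∀ x ∈ closure (semiTube ω), x.fst ∈ closure ω := fun x hx ↦
    fst_mem_closure_of_mem_closure_semiTube hx
  obtain ⟨Λ, g, hg⟩ := exists_isGroundState hs0 hs1.le 0 hω_open hω_conn.nonempty hω_bdd
  have hw : (weight s 0 : EuclideanSpace ℝ (Fin d) → ℝ) = fracWeight s := funext (weight_zero s)
  obtain ⟨g₀, hg₀⟩ : ∃ g₀ : formGraph (fracWeight s) ω, IsGroundState g₀ Λ := hw ▸ ⟨g, hg⟩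
  refine ⟨Λ, hg₀.isLeast_realEigenvalues, Set.Subset.antisymm ?_ ?_⟩
  · refine LinearPMap.spectrumC_subset_of_le (formEmbedding s (semiTube ω))
      (mem_operator_graph_iff s _) hg₀.nonneg fun v ↦ ?_
    have h1 := hg₀.lower_bound_of_cylinder hs0.le hcl v
    rw [norm_sq_formGraph, Submodule.coe_norm, coe_formEmbedding]
    linarith
  · rintro _ ⟨l, hl, rfl⟩
    obtain ⟨η, g', hg'⟩ :=
      exists_isGroundState_of_le hs0 hs1.le hω_open hω_conn.nonempty hω_bdd hg hl
    refine LinearPMap.mem_spectrumC_of_approx (formEmbedding s (semiTube ω))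
      (mem_operator_graph_iff s _) fun ε hε ↦ ?_
    exact exists_approx_eigenfunction hs0 hs1.le hcl
      (fun x hx hx' ↦ mem_closure_semiTube hx hx') hg' hε
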